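/- Fix a constant $c\in\mathbb N$. There are a randomized one-pass streaming algorithm $\mathcal A$ (a single program for a random access machine with logarithmic cost and access to independent fair coin flips, which are read one after the other and have to be stored if they are needed again) and constants $C,d$, all depending only on $c$, such that the following holds for all integers $n\ge 1$, $k\ge 0$ and all real $0<\delta<1$, where $\mathcal A$ is given $n$, $k$ and $\lceil 1/\delta\rceil$. Let $S$ be a sequence of at most $n^c$ insertions and deletions of edges on the vertex set $\{0,\dots,n-1\}$, starting from the graph without edges, fixed in advance (independently of the coins), in which only absent edges are inserted and only present edges are deleted. Suppose that after each prefix of $S$, the current graph has a vertex cover with at most $k$ vertices. Then, when $\mathcal A$ processes $S$ update by update: 1. for every outcome of the coins, $\mathcal A$ halts, it uses at no moment more than $C\max(k,1)^2\,(1+\log(n/\delta))^d$ bits of memory (that is, $\tilde O(k^2)$ space), and after the last update it extracts its output from its memory in time at most $C\,2^{2k^2}(1+\log(n/\delta))^d$ (that is, in time $\tilde O(2^{2k^2})$); 2. with probability at least $1-\delta/n^c$ over the coins, the output is a vertex cover of the final graph with at most $k$ vertices. -/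

import Mathlib

/-! ### A random access machine with logarithmic cost, one-way coin tape and one-way output tape

The memory is a finitely supported map from addresses to natural numbers. -/

namespace StreamRAM

/-- Binary operations of the machine. -/
inductive Op
  | add | sub | mul | div | mod | and | xor | eq | lt

/-- Comparisons return `1` for true and `0` for false; subtraction is truncated. -/
def Op.val : Op → ℕ → ℕ → ℕ
  | add, a, b => a + b
  | sub, a, b => a - b
  | mul, a, b => a * b
  | div, a, b => a / b
  | mod, a, b => a % b
  | and, a, b => a &&& b
  | xor, a, b => a ^^^ b
  | eq, a, b => if a = b then 1 else 0
  | lt, a, b => if a < b then 1 else 0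

/-- Expressions: literals, the content of the cell whose address is given by an expression
(indirect addressing), and binary operations. -/
inductive Expr
  | lit (v : ℕ)
  | mem (a : Expr)
  | op (o : Op) (a b : Expr)

/-- The value of an expression in a given memory. -/
def Expr.val (M : ℕ →₀ ℕ) : Expr → ℕ
  | lit v => v
  | mem a => M (a.val M)
  | op o a b => o.val (a.val M) (b.val M)

/-- The logarithmic cost of evaluating an expression: every elementary operation costs one plus
the binary lengths of all the numbers (addresses, operands, result) that it handles. -/
def Expr.cost (M : ℕ →₀ ℕ) : Expr → ℕ
  | lit v => 1 + v.size
  | mem a => a.cost M + 1 + (a.val M).size + (M (a.val M)).size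
  | op o a b =>
      a.cost M + b.cost M + 1 + (a.val M).size + (b.val M).size + (o.val (a.val M) (b.val M)).size

/-- Programs. -/
inductive Cmd
  | skip
  /-- store the value of `e` in the cell with address `d` -/
  | assign (d e : Expr)
  /-- read the next bit of the coin tape into the cell with address `d` -/
  | flip (d : Expr)
  /-- append the value of `e` to the output tape -/
  | emit (e : Expr)
  | seq (p q : Cmd)
  /-- run `p` if the value of `e` is nonzero, and `q` otherwise -/
  | ite (e : Expr) (p q : Cmd)
  /-- run `p` as long as the value of `e` is nonzero -/
  | loop (e : Expr) (p : Cmd)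

/-- The number of bits held in memory: every nonzero cell is charged the binary lengths of its
address and of its content. -/
def memBits (M : ℕ →₀ ℕ) : ℕ := M.sum fun a v => a.size + v.size

/-- A configuration of the machine: its memory, the number of coins read so far, the output written
so far, the time used so far, and the largest number of bits used at any moment so far. -/
structure State where
  mem : ℕ →₀ ℕ
  coin : ℕ
  out : List ℕ
  time : ℕ
  peak : ℕ

/-- Account for an evaluation of cost `w`: it takes `w` units of time, and at most `w` bits of
working storage in addition to the memory. -/
def State.charge (s : State) (w : ℕ) : State :=
  { s with time := s.time + w, peak := max s.peak (memBits s.mem + w) }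

/-- Write `v` into the cell with address `a`. -/
noncomputable def State.write (s : State) (a v : ℕ) : State :=
  { s with mem := s.mem.update a v, peak := max s.peak (memBits (s.mem.update a v)) }

/-- Read the next coin of the tape `ω` into the cell with address `a`. The tape is read once, from
left to right: a coin that is needed again has to be kept in memory. -/
noncomputable def State.toss (ω : ℕ → Bool) (s : State) (a : ℕ) : State :=
  { s.write a (if ω s.coin then 1 else 0) with coin := s.coin + 1 }

/-- Append `v` to the output. -/
def State.print (s : State) (v : ℕ) : State := { s with out := s.out ++ [v] }

/-- `Exec ω p s t`: with coin tape `ω`, the program `p` started in `s` halts in `t`. -/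
inductive Exec (ω : ℕ → Bool) : Cmd → State → State → Prop
  | skip (s : State) : Exec ω .skip s s
  | assign (d e : Expr) (s : State) :
      Exec ω (.assign d e) s
        ((s.charge (d.cost s.mem + e.cost s.mem)).write (d.val s.mem) (e.val s.mem))
  | flip (d : Expr) (s : State) :
      Exec ω (.flip d) s ((s.charge (d.cost s.mem + 1)).toss ω (d.val s.mem))
  | emit (e : Expr) (s : State) :
      Exec ω (.emit e) s ((s.charge (e.cost s.mem)).print (e.val s.mem))
  | seq {p q : Cmd} {s t u : State} :
      Exec ω p s t → Exec ω q t u → Exec ω (.seq p q) s u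
  | ite_true {e : Expr} {p q : Cmd} {s t : State} :
      e.val s.mem ≠ 0 → Exec ω p (s.charge (e.cost s.mem)) t → Exec ω (.ite e p q) s t
  | ite_false {e : Expr} {p q : Cmd} {s t : State} :
      e.val s.mem = 0 → Exec ω q (s.charge (e.cost s.mem)) t → Exec ω (.ite e p q) s t
  | loop_true {e : Expr} {p : Cmd} {s t u : State} :
      e.val s.mem ≠ 0 → Exec ω p (s.charge (e.cost s.mem)) t → Exec ω (.loop e p) t u →
        Exec ω (.loop e p) s u
  | loop_false {e : Expr} {p : Cmd} {s : State} :
      e.val s.mem = 0 → Exec ω (.loop e p) s (s.charge (e.cost s.mem))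

/-- The law of a tape of independent fair coins. -/
noncomputable def coinMeasure : MeasureTheory.Measure (ℕ → Bool) :=
  MeasureTheory.Measure.infinitePi fun _ : ℕ => (PMF.uniformOfFintype Bool).toMeasure

/-! ### Dynamic graph streams -/

/-- An update on the vertex set `Fin n`: insertion (`ins = true`) or deletion (`ins = false`) of the
undirected edge with the distinct ends `u` and `v`, which are presented in either order. -/
structure EdgeUpdate (n : ℕ) where
  ins : Bool
  u : Fin n
  v : Fin n
  ne : u ≠ v

/-- The effect of an update on the current graph. -/
def EdgeUpdate.apply {n : ℕ} (G : SimpleGraph (Fin n)) (x : EdgeUpdate n) : SimpleGraph (Fin n) :=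
  if x.ins then G ⊔ SimpleGraph.edge x.u x.v else G \ SimpleGraph.edge x.u x.v

/-- The graph defined by a sequence of updates, starting from the graph without edges. -/
def graphAfter {n : ℕ} (S : List (EdgeUpdate n)) : SimpleGraph (Fin n) :=
  S.foldl EdgeUpdate.apply ⊥

/-- Only absent edges are inserted and only present edges are deleted. -/
def IsDynamicStream {n : ℕ} (S : List (EdgeUpdate n)) : Prop :=
  ∀ (i : ℕ) (hi : i < S.length),
    S[i].ins = true ↔ ¬ (graphAfter (S.take i)).Adj S[i].u S[i].v

/-- At every time, the current graph has a vertex cover with at most `k` vertices. -/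
def VertexCoverPromise {n : ℕ} (k : ℕ) (S : List (EdgeUpdate n)) : Prop :=
  ∀ i ≤ S.length, ∃ T : Finset (Fin n), T.card ≤ k ∧ (graphAfter (S.take i)).IsVertexCover T

/-! ### One-pass streaming algorithms -/

/-- A one-pass streaming algorithm: a program run once before the stream, a program run once for
each update, and a program run after the end of the stream. All three share the memory. -/
structure StreamAlgorithm where
  init : Cmd
  update : Cmd
  extract : Cmd

/-- The machine at the start: the cells `0`, `1`, `2` hold the three parameters, and all other
cells hold `0`. -/
noncomputable def startState (n k D : ℕ) : State where
  mem := ((Finsupp.single 0 n).update 1 k).update 2 D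
  coin := 0
  out := []
  time := 0
  peak := memBits (((Finsupp.single 0 n).update 1 k).update 2 D)

/-- The next update of the stream is placed in the cells `3`, `4`, `5`. -/
noncomputable def State.feed {n : ℕ} (s : State) (x : EdgeUpdate n) : State :=
  ((s.write 3 (if x.ins then 1 else 0)).write 4 x.u).write 5 x.v

/-- `p` processes the updates of the stream one after the other. -/
inductive Pass {n : ℕ} (ω : ℕ → Bool) (p : Cmd) : List (EdgeUpdate n) → State → State → Prop
  | nil (s : State) : Pass ω p [] s s
  | cons {x : EdgeUpdate n} {S : List (EdgeUpdate n)} {s t u : State} :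
      Exec ω p (s.feed x) t → Pass ω p S t u → Pass ω p (x :: S) s u

/-- With coin tape `ω` and parameters `n, k, D`, the algorithm `A` reaches the end of the stream `S`
in the state `s`, and from there its extraction halts in the state `t`. -/
def StreamAlgorithm.Run (A : StreamAlgorithm) (ω : ℕ → Bool) {n : ℕ} (k D : ℕ)
    (S : List (EdgeUpdate n)) (s t : State) : Prop :=
  ∃ r : State, Exec ω A.init (startState n k D) r ∧ Pass ω A.update S r s ∧ Exec ω A.extract s t

/-- The list `L` consists of at most `k` vertices, which form a vertex cover of `G`. -/
def IsSolution {n : ℕ} (k : ℕ) (G : SimpleGraph (Fin n)) (L : List ℕ) : Prop :=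
  L.length ≤ k ∧ (∀ a ∈ L, a < n) ∧ G.IsVertexCover {v : Fin n | (v : ℕ) ∈ L}

end StreamRAM

/-!
The algorithm flips no coins, hence never fails. It keeps a vertex cover `H` of the current graph
with at most `k` vertices and assigns every edge to its first end in `H`, which splits the edges
into one star for each vertex of `H`. A star is not stored but sketched: the residues modulo a
prime `p > n²` of the `r`-th powers of the codes of its edges are summed up over the star, for
`r = 0, …, 2k`. These sums change by one power at an insertion or deletion. The sum for `r = 0`
counts the edges, and by Vandermonde's determinant all of them together determine a star with at
most `k` edges.

An update has to change `H` only if an edge is inserted that `H` does not cover. A vertex whose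
star has more than `k` edges belongs to every vertex cover with at most `k` vertices, so it is
kept together with its sketch. The at most `k²` edges of the other stars are recovered from their
sketches by exhaustive search. A second search extends the list of the kept vertices until it
covers these edges and the new one, and the sketches of the recovered edges are recomputed for the
extended list. All numbers involved have `O(k² log n)` bits and are packed into a fixed number of
cells. To extract the output, the machine only prints the list `H`.
-/

namespace StreamRAM

open Finset

/-! ### Positional expansions -/

/-- The digit with index `i` of `x` in base `b`, counted from the least significant one. It reads
the packed lists of this file, in which the entry with index `i` is multiplied by `b ^ i`. -/
def digit (b x i : ℕ) : ℕ := x / b ^ i % b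

section Digits

variable {b R : ℕ} {a : ℕ → ℕ}

theorem digit_lt (hb : 0 < b) (x i : ℕ) : digit b x i < b := Nat.mod_lt _ hb

theorem digit_zero_right (b x : ℕ) : digit b x 0 = x % b := by simp [digit]

theorem digit_div_self (b x i : ℕ) : digit b (x / b) i = digit b x (i + 1) := by
  rw [digit, digit, Nat.div_div_eq_div_mul, pow_succ']

theorem digit_add_mul_pow_add {x i : ℕ} (hx : x < b ^ i) (y j : ℕ) :
    digit b (x + y * b ^ i) (i + j) = digit b y j := by
  rw [digit, pow_add, ← Nat.div_div_eq_div_mul, Nat.add_mul_div_right _ _ (Nat.zero_lt_of_lt hx),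
    Nat.div_eq_of_lt hx, zero_add, digit]

theorem digit_add_mul_pow {x y i : ℕ} (hx : x < b ^ i) (hy : y < b) :
    digit b (x + y * b ^ i) i = y := by
  simpa [digit_zero_right, Nat.mod_eq_of_lt hy] using digit_add_mul_pow_add hx y 0

theorem digit_add_mul_pow_of_lt {i j : ℕ} (hij : i < j) (x y : ℕ) :
    digit b (x + y * b ^ j) i = digit b x i := by
  obtain ⟨d, rfl⟩ := Nat.exists_eq_add_of_lt hij
  rcases b.eq_zero_or_pos with rfl | hb
  · simp
  rw [digit, digit, show y * b ^ (i + d + 1) = b * (y * b ^ d) * b ^ i by ring,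
    Nat.add_mul_div_right _ _ (pow_pos hb i), Nat.add_mul_mod_self_left]

theorem add_mul_pow_lt {x y i : ℕ} (hx : x < b ^ i) (hy : y < b) : x + y * b ^ i < b ^ (i + 1) :=
  calc x + y * b ^ i < (y + 1) * b ^ i := by linarith
    _ ≤ b * b ^ i := Nat.mul_le_mul_right _ hy
    _ = b ^ (i + 1) := (pow_succ' b i).symm

theorem sum_mul_pow_lt (ha : ∀ r < R, a r < b) : ∑ r ∈ range R, a r * b ^ r < b ^ R := by
  induction R with
  | zero => simp
  | succ R ih =>
    rw [sum_range_succ]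
    exact add_mul_pow_lt (ih fun r hr => ha r (by omega)) (ha R (by omega))

theorem digit_sum_mul_pow (ha : ∀ r < R, a r < b) {i : ℕ} (hi : i < R) :
    digit b (∑ r ∈ range R, a r * b ^ r) i = a i := by
  induction R with
  | zero => omega
  | succ R ih =>
    have hlow : ∀ r < R, a r < b := fun r hr => ha r (by omega)
    rw [sum_range_succ]
    rcases Nat.lt_succ_iff_lt_or_eq.1 hi with hlt | rfl
    · rw [digit_add_mul_pow_of_lt hlt, ih hlow hlt]
    · exact digit_add_mul_pow (sum_mul_pow_lt hlow) (ha i hi)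

theorem eq_of_sum_mul_pow_eq {a' : ℕ → ℕ} (ha : ∀ r < R, a r < b) (ha' : ∀ r < R, a' r < b)
    (h : ∑ r ∈ range R, a r * b ^ r = ∑ r ∈ range R, a' r * b ^ r) {i : ℕ} (hi : i < R) :
    a i = a' i := by
  rw [← digit_sum_mul_pow ha hi, h, digit_sum_mul_pow ha' hi]

theorem exists_digits_of_finset (T : Finset ℕ) (hT : ∀ t ∈ T, t < b) :
    ∃ X < b ^ #T, ∀ t ∈ T, ∃ j < #T, digit b X j = t := by
  induction T using Finset.induction_on with
  | empty => exact ⟨0, by simp, by simp⟩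
  | insert t T ht ih =>
    obtain ⟨X, hX, hdigit⟩ := ih fun s hs => hT s (mem_insert_of_mem hs)
    have htb := hT t (mem_insert_self _ _)
    rw [card_insert_of_notMem ht]
    refine ⟨X + t * b ^ #T, add_mul_pow_lt hX htb, fun s hs => ?_⟩
    rcases mem_insert.1 hs with rfl | hs
    · exact ⟨#T, by omega, digit_add_mul_pow hX htb⟩
    · obtain ⟨j, hj, rfl⟩ := hdigit s hs
      exact ⟨j, by omega, digit_add_mul_pow_of_lt hj _ _⟩

/-- The entries `a i` with `i < k` and `P i`, packed in base `b` without gaps and in their order: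
the entry with index `i` moves to the place `Nat.count P i`. -/
def squeeze (P : ℕ → Prop) [DecidablePred P] (b : ℕ) (a : ℕ → ℕ) (k : ℕ) : ℕ :=
  ∑ i ∈ range k, if P i then a i * b ^ Nat.count P i else 0

variable {P : ℕ → Prop} [DecidablePred P]

theorem squeeze_succ_of_pos {k : ℕ} (h : P k) :
    squeeze P b a (k + 1) = squeeze P b a k + a k * b ^ Nat.count P k := by
  rw [squeeze, sum_range_succ, if_pos h, squeeze]

theorem squeeze_succ_of_neg {k : ℕ} (h : ¬ P k) : squeeze P b a (k + 1) = squeeze P b a k := by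
  rw [squeeze, sum_range_succ, if_neg h, add_zero, squeeze]

theorem squeeze_lt {k : ℕ} (ha : ∀ i < k, a i < b) : squeeze P b a k < b ^ Nat.count P k := by
  induction k with
  | zero => simp [squeeze]
  | succ k ih =>
    have hlow := ih fun i hi => ha i (by omega)
    by_cases h : P k
    · rw [squeeze_succ_of_pos h, Nat.count_succ, if_pos h]
      exact add_mul_pow_lt hlow (ha k (by omega))
    · rwa [squeeze_succ_of_neg h, Nat.count_succ, if_neg h, add_zero]

theorem digit_squeeze_add {k i : ℕ} (ha : ∀ i < k, a i < b) (X : ℕ) (hi : i < k) (hPi : P i) :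
    digit b (squeeze P b a k + X * b ^ Nat.count P k) (Nat.count P i) = a i := by
  rw [digit_add_mul_pow_of_lt (Nat.count_strict_mono hPi hi)]
  induction k with
  | zero => omega
  | succ k ih =>
    have hlow : ∀ j < k, a j < b := fun j hj => ha j (by omega)
    rcases Nat.lt_succ_iff_lt_or_eq.1 hi with hlt | rfl
    · by_cases h : P k
      · rw [squeeze_succ_of_pos h, digit_add_mul_pow_of_lt (Nat.count_strict_mono hPi hlt),
          ih hlow hlt]
      · rw [squeeze_succ_of_neg h, ih hlow hlt]
    · rw [squeeze_succ_of_pos hPi, digit_add_mul_pow (squeeze_lt hlow) (ha i hi)]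

theorem exists_count_eq_of_lt_count {j k : ℕ} (h : j < Nat.count P k) :
    ∃ i < k, P i ∧ Nat.count P i = j := by
  induction k with
  | zero => simp at h
  | succ k ih =>
    by_cases hj : j < Nat.count P k
    · obtain ⟨i, hi, hPi⟩ := ih hj
      exact ⟨i, by omega, hPi⟩
    · have hlt : Nat.count P k < Nat.count P (k + 1) := by omega
      have hle : Nat.count P (k + 1) ≤ Nat.count P k + 1 := by grind
      exact ⟨k, k.lt_succ_self, Nat.count_lt_count_succ_iff.1 hlt, by omega⟩

theorem sum_filter_eq_squeeze {ι : Type*} {A : Finset ι} {f : ι → ℕ} {k : ℕ}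
    (hf : ∀ x ∈ A, f x < k) (g : ι → ℕ) :
    ∑ x ∈ A with P (f x), g x * b ^ Nat.count P (f x) =
      squeeze P b (fun i => ∑ x ∈ A with f x = i, g x) k := by
  rw [sum_filter, ← sum_fiberwise_of_maps_to fun x hx => mem_range.2 (hf x hx), squeeze]
  refine sum_congr rfl fun i _ => ?_
  split_ifs with hi
  · rw [sum_mul]
    exact sum_congr rfl fun x hx => by rw [(mem_filter.1 hx).2, if_pos hi]
  · exact sum_eq_zero fun x hx => by rw [(mem_filter.1 hx).2, if_neg hi]

theorem sum_filter_not_eq_sum_range {ι : Type*} {A : Finset ι} {f : ι → ℕ} {k : ℕ}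
    (hf : ∀ x ∈ A, f x < k) (g : ι → ℕ) :
    ∑ x ∈ A with ¬ P (f x), g x * b ^ f x =
      ∑ i ∈ range k, if P i then 0 else (∑ x ∈ A with f x = i, g x) * b ^ i := by
  rw [sum_filter, ← sum_fiberwise_of_maps_to fun x hx => mem_range.2 (hf x hx)]
  refine sum_congr rfl fun i _ => ?_
  split_ifs with hi
  · exact sum_eq_zero fun x hx => by rw [(mem_filter.1 hx).2, if_neg (not_not.2 hi)]
  · rw [sum_mul]
    exact sum_congr rfl fun x hx => by rw [(mem_filter.1 hx).2, if_pos hi]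

end Digits

/-! ### Recovery of small multisets from power sums -/

section PowerSums

variable {F : Type*} [Field F]

theorem eq_zero_of_sum_mul_pow_eq_zero {A : Finset F} {c : F → F}
    (h : ∀ r < #A, ∑ a ∈ A, c a * a ^ r = 0) : ∀ a ∈ A, c a = 0 := by
  let f : Fin #A → F := fun i => A.equivFin.symm i
  have hf : Function.Injective f := Subtype.val_injective.comp A.equivFin.symm.injective
  have hc : c ∘ f = 0 := Matrix.eq_zero_of_forall_pow_sum_mul_pow_eq_zero hf fun r => by
    rw [← h r r.2, ← sum_coe_sort A fun a => c a * a ^ (r : ℕ)]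
    exact Fintype.sum_equiv A.equivFin.symm _ _ fun _ => rfl
  intro a ha
  simpa [f] using congrFun hc (A.equivFin ⟨a, ha⟩)

theorem multiset_eq_of_powerSums_eq {k : ℕ} (hk : Set.InjOn (Nat.cast : ℕ → F) (Set.Iic k))
    {m₁ m₂ : Multiset F} (hm₁ : m₁.card ≤ k) (hm₂ : m₂.card ≤ k)
    (h : ∀ r < m₁.card + m₂.card, (m₁.map (· ^ r)).sum = (m₂.map (· ^ r)).sum) : m₁ = m₂ := by
  classical
  set A : Finset F := m₁.toFinset ∪ m₂.toFinset
  have hA : #A ≤ m₁.card + m₂.card := (card_union_le _ _).trans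
    (add_le_add (Multiset.toFinset_card_le _) (Multiset.toFinset_card_le _))
  have powerSum_eq (m : Multiset F) (hm : m.toFinset ⊆ A) (r : ℕ) :
      (m.map (· ^ r)).sum = ∑ a ∈ A, (m.count a : F) * a ^ r := by
    simp only [Finset.sum_multiset_map_count, nsmul_eq_mul]
    exact sum_subset hm fun a _ ha => by
      simp [Multiset.count_eq_zero.2 (mt Multiset.mem_toFinset.2 ha)]
  have hcount := eq_zero_of_sum_mul_pow_eq_zero (A := A)
    (c := fun a => (m₁.count a : F) - m₂.count a) fun r hr => by
      simp only [sub_mul, sum_sub_distrib]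
      rw [← powerSum_eq m₁ subset_union_left, ← powerSum_eq m₂ subset_union_right,
        h r (by omega), sub_self]
  ext a
  by_cases ha : a ∈ A
  · exact hk ((Multiset.count_le_card a m₁).trans hm₁) ((Multiset.count_le_card a m₂).trans hm₂)
      (sub_eq_zero.1 (hcount a ha))
  · simp only [A, mem_union, Multiset.mem_toFinset, not_or] at ha
    rw [Multiset.count_eq_zero.2 ha.1, Multiset.count_eq_zero.2 ha.2]

end PowerSums

theorem natCast_zmod_injOn {p k : ℕ} (hk : k < p) :
    Set.InjOn (Nat.cast : ℕ → ZMod p) (Set.Iic k) := by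
  intro a ha b hb hab
  rw [Set.mem_Iic] at ha hb
  rw [← ZMod.val_natCast_of_lt (ha.trans_lt hk), hab, ZMod.val_natCast_of_lt (hb.trans_lt hk)]

theorem multiset_eq_of_powerSums_mod_eq {p k : ℕ} (hp : p.Prime) (hk : k < p) {m₁ m₂ : Multiset ℕ}
    (hm₁ : ∀ a ∈ m₁, a < p) (hm₂ : ∀ a ∈ m₂, a < p) (hc₁ : m₁.card ≤ k) (hc₂ : m₂.card ≤ k)
    (h : ∀ r < 2 * k, (m₁.map fun e => e ^ r % p).sum = (m₂.map fun e => e ^ r % p).sum) :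
    m₁ = m₂ := by
  have : Fact p.Prime := ⟨hp⟩
  have cast_powerSum (m : Multiset ℕ) (r : ℕ) :
      (((m.map fun e => e ^ r % p).sum : ℕ) : ZMod p) =
        ((m.map (Nat.cast : ℕ → ZMod p)).map (· ^ r)).sum := by
    simp [Multiset.map_map, Nat.cast_multiset_sum]
  have map_val_map_cast (m : Multiset ℕ) (hm : ∀ a ∈ m, a < p) :
      (m.map (Nat.cast : ℕ → ZMod p)).map ZMod.val = m := by
    rw [Multiset.map_map]
    exact (Multiset.map_congr rfl fun a ha => ZMod.val_natCast_of_lt (hm a ha)).trans m.map_id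
  rw [← map_val_map_cast m₁ hm₁, ← map_val_map_cast m₂ hm₂]
  congr 1
  refine multiset_eq_of_powerSums_eq (natCast_zmod_injOn hk) (by simpa) (by simpa) fun r hr => ?_
  rw [Multiset.card_map, Multiset.card_map] at hr
  rw [← cast_powerSum, ← cast_powerSum, h r (by omega)]

/-! ### Linear sketches of sets of edges -/

/-- The linear sketch of the number `e`: the residues modulo `p` of its first `R` powers, packed in
base `p * p`, so that up to `p` sketches can be added without a carry. -/
def sketch (p R e : ℕ) : ℕ := ∑ r ∈ range R, e ^ r % p * (p * p) ^ r

/-- The sum of the sketches of the elements of a multiset. -/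
def sketchSum (p R : ℕ) (m : Multiset ℕ) : ℕ := (m.map (sketch p R)).sum

section Sketch

variable {p R : ℕ} {m : Multiset ℕ}

theorem sketchSum_singleton (p R e : ℕ) : sketchSum p R {e} = sketch p R e := by simp [sketchSum]

theorem sketchSum_eq_sum_range (p R : ℕ) (m : Multiset ℕ) :
    sketchSum p R m = ∑ r ∈ range R, (m.map fun e => e ^ r % p).sum * (p * p) ^ r := by
  simp only [← Multiset.sum_map_mul_right]
  exact Multiset.sum_map_sum_map m (range R).val

theorem residueSum_lt (hp : 0 < p) (hm : m.card ≤ p) (r : ℕ) :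
    (m.map fun e => e ^ r % p).sum < p * p := by
  have hsum : (m.map fun e => e ^ r % p).sum ≤ m.card * (p - 1) := by
    simpa using Multiset.sum_le_card_nsmul (m.map fun e => e ^ r % p) (p - 1) (by
      simpa using fun e _ => Nat.le_pred_of_lt (Nat.mod_lt (e ^ r) hp))
  calc _ ≤ m.card * (p - 1) := hsum
    _ ≤ p * (p - 1) := Nat.mul_le_mul_right _ hm
    _ < p * p := Nat.mul_lt_mul_of_pos_left (by omega) hp

theorem sketchSum_lt (hp : 0 < p) (hm : m.card ≤ p) : sketchSum p R m < (p * p) ^ R := by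
  rw [sketchSum_eq_sum_range]
  exact sum_mul_pow_lt fun r _ => residueSum_lt hp hm r

theorem sketch_lt (hp : 0 < p) (e : ℕ) : sketch p R e < (p * p) ^ R := by
  rw [← sketchSum_singleton]
  exact sketchSum_lt hp (by rwa [Multiset.card_singleton])

theorem sketchSum_mod (hp : 1 < p) (hR : 0 < R) (hm : m.card ≤ p) :
    sketchSum p R m % (p * p) = m.card := by
  rw [← digit_zero_right, sketchSum_eq_sum_range,
    digit_sum_mul_pow (fun r _ => residueSum_lt (by omega) hm r) hR]
  simp [Nat.mod_eq_of_lt hp]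

theorem sketch_pos (hp : 1 < p) (hR : 0 < R) (e : ℕ) : 0 < sketch p R e := by
  have h := sketchSum_mod hp hR (m := {e}) (by simpa using hp.le)
  rw [sketchSum_singleton, Multiset.card_singleton] at h
  exact Nat.pos_of_ne_zero fun h₀ => by simp [h₀] at h

theorem multiset_eq_of_sketchSum_eq {k : ℕ} (hp : p.Prime) (hk : k < p) {m₁ m₂ : Multiset ℕ}
    (hm₁ : ∀ a ∈ m₁, a < p) (hm₂ : ∀ a ∈ m₂, a < p) (hc₁ : m₁.card ≤ k) (hc₂ : m₂.card ≤ p)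
    (h : sketchSum p (2 * k + 1) m₁ = sketchSum p (2 * k + 1) m₂) : m₁ = m₂ := by
  have hcard : m₁.card = m₂.card := by
    rw [← sketchSum_mod hp.one_lt (2 * k).succ_pos (hc₁.trans hk.le), h,
      sketchSum_mod hp.one_lt (2 * k).succ_pos hc₂]
  rw [sketchSum_eq_sum_range, sketchSum_eq_sum_range] at h
  exact multiset_eq_of_powerSums_mod_eq hp hk hm₁ hm₂ hc₁ (hcard ▸ hc₁) fun r hr =>
    eq_of_sum_mul_pow_eq (fun s _ => residueSum_lt hp.pos (hc₁.trans hk.le) s)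
      (fun s _ => residueSum_lt hp.pos hc₂ s) h (by omega)

end Sketch

/-! ### Edges and lists of vertices -/

/-- The number that codes the edge with the ends `u` and `v` of a graph on `n` vertices. Its
quotient by `n` is the smaller end, its remainder the larger one. -/
def edgeCode (n u v : ℕ) : ℕ := min u v * n + max u v

section EdgeCode

variable {n u v : ℕ}

theorem edgeCode_div (hu : u < n) (hv : v < n) : edgeCode n u v / n = min u v := by
  rw [edgeCode, mul_comm, Nat.mul_add_div (by omega), Nat.div_eq_of_lt (max_lt hu hv), add_zero]

theorem edgeCode_mod (hu : u < n) (hv : v < n) : edgeCode n u v % n = max u v := by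
  rw [edgeCode, mul_comm, Nat.mul_add_mod, Nat.mod_eq_of_lt (max_lt hu hv)]

theorem edgeCode_lt (hu : u < n) (hv : v < n) : edgeCode n u v < n * n :=
  calc edgeCode n u v < (min u v + 1) * n := by
        rw [edgeCode, add_mul, one_mul]
        exact Nat.add_lt_add_left (max_lt hu hv) _
    _ ≤ n * n := Nat.mul_le_mul_right _ (Nat.succ_le_of_lt (min_lt_of_left_lt hu))

theorem edgeCode_comm (n u v : ℕ) : edgeCode n u v = edgeCode n v u := by
  rw [edgeCode, edgeCode, min_comm, max_comm]

theorem edgeCode_div_mod {e : ℕ} (h : e / n < e % n) : edgeCode n (e / n) (e % n) = e := by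
  rw [edgeCode, min_eq_left h.le, max_eq_right h.le, Nat.div_add_mod']

end EdgeCode

/-- The set `E` consists of codes of edges of a graph on `n` vertices. -/
def IsCodes (n : ℕ) (E : Finset ℕ) : Prop := ∀ e ∈ E, e < n * n ∧ e / n < e % n

section IsCodes

variable {n e : ℕ} {E : Finset ℕ}

theorem IsCodes.card_le (h : IsCodes n E) : #E ≤ n * n := by
  simpa using card_le_card (t := range (n * n)) fun e he => mem_range.2 (h e he).1

theorem IsCodes.pos (h : IsCodes n E) (he : e ∈ E) : 0 < e :=
  Nat.pos_of_ne_zero fun h₀ => by simpa [h₀] using (h e he).2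

end IsCodes

/-- The set `T` consists of at most `k` vertices, which cover the edges with a code in `E`. -/
structure IsSmallCover (n k : ℕ) (T E : Finset ℕ) : Prop where
  card_le : #T ≤ k
  lt : ∀ t ∈ T, t < n
  covers : ∀ e ∈ E, e / n ∈ T ∨ e % n ∈ T

theorem IsSmallCover.subset {n k : ℕ} {T E E' : Finset ℕ} (h : IsSmallCover n k T E)
    (hE : E' ⊆ E) : IsSmallCover n k T E' :=
  ⟨h.card_le, h.lt, fun e he => h.covers e (hE he)⟩

/-- The vertex at the place `i` of the list `U`, packed in base `n`, is an end of the edge `e`. -/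
def Hit (n e U i : ℕ) : Prop := digit n U i = e / n ∨ digit n U i = e % n

instance (n e U : ℕ) : DecidablePred (Hit n e U) := fun _ => instDecidableOr

/-- The first place below `k` at which the list `U` contains an end of the edge `e`; if there is
none, then it is `k`. -/
def firstHit (n e k U : ℕ) : ℕ := Nat.find (p := fun i => k ≤ i ∨ Hit n e U i) ⟨k, .inl le_rfl⟩

section FirstHit

variable {n e k U i : ℕ}

theorem firstHit_le (n e k U : ℕ) : firstHit n e k U ≤ k := Nat.find_min' _ (.inl le_rfl)

theorem hit_firstHit (h : firstHit n e k U < k) : Hit n e U (firstHit n e k U) :=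
  (Nat.find_spec (p := fun i => k ≤ i ∨ Hit n e U i) _).resolve_left h.not_ge

theorem not_hit_of_lt_firstHit (h : i < firstHit n e k U) : ¬ Hit n e U i :=
  fun hit => Nat.find_min _ h (.inr hit)

theorem firstHit_le_of_hit (h : Hit n e U i) : firstHit n e k U ≤ i :=
  Nat.find_min' _ (.inr h)

theorem firstHit_eq (hi : i < k) (h : Hit n e U i) (hmin : ∀ j < i, ¬ Hit n e U j) :
    firstHit n e k U = i :=
  le_antisymm (firstHit_le_of_hit h) <| not_lt.1 fun hlt => hmin _ hlt (hit_firstHit (hlt.trans hi))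

end FirstHit

/-! ### Sketches sorted by the vertices of a list -/

/-- The base in which the sketches of the stars are packed. -/
def sketchBase (p k : ℕ) : ℕ := (p * p) ^ (2 * k + 1)

/-- The sketch of the edge `e`, placed at the first vertex of the list `H` that is an end of `e`. -/
def load (n k p H e : ℕ) : ℕ := sketch p (2 * k + 1) e * sketchBase p k ^ firstHit n e k H

/-- The sum of the loads of the elements of a multiset. -/
def loadSum (n k p H : ℕ) (m : Multiset ℕ) : ℕ := (m.map (load n k p H)).sum

section Load

variable {n k p H : ℕ} {m : Multiset ℕ}

theorem loadSum_cons (n k p H e : ℕ) (m : Multiset ℕ) :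
    loadSum n k p H (e ::ₘ m) = load n k p H e + loadSum n k p H m := by simp [loadSum]

theorem sketchBase_pos (hp : 0 < p) (k : ℕ) : 0 < sketchBase p k := pow_pos (mul_pos hp hp) _

theorem loadSum_eq_sum_range (n k p H : ℕ) (m : Multiset ℕ) :
    loadSum n k p H m = ∑ i ∈ range (k + 1),
      sketchSum p (2 * k + 1) (m.filter fun e => firstHit n e k H = i) * sketchBase p k ^ i := by
  induction m using Multiset.induction_on with
  | empty => simp [loadSum, sketchSum]
  | cons e m ih =>
    have term_cons (i : ℕ) :
        sketchSum p (2 * k + 1) ((e ::ₘ m).filter fun e => firstHit n e k H = i) *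
          sketchBase p k ^ i =
        (if firstHit n e k H = i then sketch p (2 * k + 1) e * sketchBase p k ^ i else 0) +
          sketchSum p (2 * k + 1) (m.filter fun e => firstHit n e k H = i) *
            sketchBase p k ^ i := by
      rw [Multiset.filter_cons]
      split_ifs <;> simp [sketchSum, add_mul]
    simp only [term_cons, sum_add_distrib, ← ih]
    rw [sum_ite_eq, if_pos (mem_range.2 (Nat.lt_succ_of_le (firstHit_le _ _ _ _))), loadSum_cons,
      load]

theorem sketchSum_filter_lt (hp : 0 < p) (hm : m.card ≤ p) (i : ℕ) :
    sketchSum p (2 * k + 1) (m.filter fun e => firstHit n e k H = i) < sketchBase p k :=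
  sketchSum_lt hp ((Multiset.card_le_card (Multiset.filter_le _ _)).trans hm)

theorem loadSum_lt_of_forall_firstHit_lt (hp : 0 < p) (hm : m.card ≤ p)
    (h : ∀ e ∈ m, firstHit n e k H < k) : loadSum n k p H m < sketchBase p k ^ k := by
  rw [loadSum_eq_sum_range, sum_range_succ, Multiset.filter_eq_nil.2 fun e he => (h e he).ne]
  simpa [sketchSum] using sum_mul_pow_lt fun i _ => sketchSum_filter_lt hp hm i

theorem firstHit_lt_of_loadSum_lt (hp : 1 < p) (h : loadSum n k p H m < sketchBase p k ^ k) {e : ℕ}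
    (he : e ∈ m) : firstHit n e k H < k := by
  refine (firstHit_le _ _ _ _).lt_of_ne fun heq => h.not_ge ?_
  calc sketchBase p k ^ k ≤ sketch p (2 * k + 1) e * sketchBase p k ^ k :=
        Nat.le_mul_of_pos_left _ (sketch_pos hp (2 * k).succ_pos e)
    _ = load n k p H e := by rw [load, heq]
    _ ≤ loadSum n k p H m :=
        Multiset.single_le_sum (fun _ _ => Nat.zero_le _) _ (Multiset.mem_map_of_mem _ he)

theorem load_lt (hp : 0 < p) (e : ℕ) : load n k p H e < sketchBase p k ^ (k + 1) :=
  calc load n k p H e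
      < sketchBase p k * sketchBase p k ^ firstHit n e k H :=
        Nat.mul_lt_mul_of_pos_right (sketch_lt hp e) (pow_pos (sketchBase_pos hp k) _)
    _ ≤ sketchBase p k * sketchBase p k ^ k := Nat.mul_le_mul_left _
        (Nat.pow_le_pow_right (sketchBase_pos hp k) (firstHit_le _ _ _ _))
    _ = sketchBase p k ^ (k + 1) := (pow_succ' _ _).symm

theorem loadSum_le (hp : 0 < p) (m : Multiset ℕ) :
    loadSum n k p H m ≤ m.card * sketchBase p k ^ (k + 1) := by
  simpa [loadSum] using Multiset.sum_le_card_nsmul (m.map (load n k p H))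
    (sketchBase p k ^ (k + 1)) (by
    simpa using fun e _ => (load_lt hp e).le)

theorem multiset_eq_of_loadSum_eq (hp : p.Prime) (hk : k < p) {m₁ m₂ : Multiset ℕ}
    (hm₁ : ∀ a ∈ m₁, a < p) (hm₂ : ∀ a ∈ m₂, a < p) (hc₁ : m₁.card ≤ p) (hc₂ : m₂.card ≤ p)
    (hstar : ∀ i, (m₁.filter fun e => firstHit n e k H = i).card ≤ k)
    (h : loadSum n k p H m₁ = loadSum n k p H m₂) : m₁ = m₂ := by
  rw [loadSum_eq_sum_range, loadSum_eq_sum_range] at h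
  have filter_eq : ∀ i < k + 1, (m₁.filter fun e => firstHit n e k H = i) =
      m₂.filter fun e => firstHit n e k H = i := fun i hi =>
    multiset_eq_of_sketchSum_eq hp hk (fun a ha => hm₁ a (Multiset.mem_filter.1 ha).1)
      (fun a ha => hm₂ a (Multiset.mem_filter.1 ha).1) (hstar i)
      ((Multiset.card_le_card (Multiset.filter_le _ _)).trans hc₂)
      (eq_of_sum_mul_pow_eq (fun i _ => sketchSum_filter_lt hp.pos hc₁ i)
        (fun i _ => sketchSum_filter_lt hp.pos hc₂ i) h hi)
  ext a
  have hcount := congrArg (Multiset.count a)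
    (filter_eq (firstHit n a k H) (Nat.lt_succ_of_le (firstHit_le _ _ _ _)))
  rwa [Multiset.count_filter, Multiset.count_filter, if_pos rfl, if_pos rfl] at hcount

end Load

/-! ### Stars, and the replacement of the vertices with a light star -/

/-- The star of the vertex at the place `i` of the list `H`: the edges in `E` for which it is the
first vertex of `H` that is an end. -/
def star (n k H : ℕ) (E : Finset ℕ) (i : ℕ) : Finset ℕ := {e ∈ E | firstHit n e k H = i}

/-- The list `H` of `k` vertices covers all edges in `E`, and `S` is the packed list of the sketches
of their stars. -/
structure Represents (n k p : ℕ) (E : Finset ℕ) (H S : ℕ) : Prop where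
  eq_loadSum : S = loadSum n k p H E.val
  firstHit_lt : ∀ e ∈ E, firstHit n e k H < k

/-- The sketch of the star with index `i`. -/
def slot (p k S i : ℕ) : ℕ := digit (sketchBase p k) S i

/-- The star with index `i` is heavy: it has more than `k` edges. Their number is read off the
sketch, as the sum of the powers with exponent `0`. -/
def Heavy (p k S i : ℕ) : Prop := k < slot p k S i % (p * p)

instance (p k S : ℕ) : DecidablePred (Heavy p k S) := fun _ => Nat.decLt _ _

/-- The number of heavy stars. -/
def heavyCount (k p S : ℕ) : ℕ := Nat.count (Heavy p k S) k

/-- The packed list of the vertices with a heavy star. -/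
def heavyVertices (n k p H S : ℕ) : ℕ := squeeze (Heavy p k S) n (digit n H) k

/-- The packed list of the sketches of the heavy stars. -/
def heavySlots (k p S : ℕ) : ℕ := squeeze (Heavy p k S) (sketchBase p k) (slot p k S) k

/-- The sketches of the light stars, at their places in `S`. -/
def lightSlots (k p S : ℕ) : ℕ :=
  ∑ i ∈ range k, if Heavy p k S i then 0 else slot p k S i * sketchBase p k ^ i

/-- The edges in a heavy star. -/
def heavyEdges (n k p : ℕ) (E : Finset ℕ) (H S : ℕ) : Finset ℕ :=
  {e ∈ E | Heavy p k S (firstHit n e k H)}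

/-- The edges in a light star. -/
def lightEdges (n k p : ℕ) (E : Finset ℕ) (H S : ℕ) : Finset ℕ :=
  {e ∈ E | ¬ Heavy p k S (firstHit n e k H)}

/-- The list of vertices in which those with a heavy star are followed by the list `X`. -/
def rebuilt (n k p H S X : ℕ) : ℕ := heavyVertices n k p H S + X * n ^ heavyCount k p S

theorem heavyCount_le (k p S : ℕ) : heavyCount k p S ≤ k := Nat.count_le _

theorem heavyVertices_lt {n : ℕ} (hn : 0 < n) (k p H S : ℕ) :
    heavyVertices n k p H S < n ^ heavyCount k p S :=
  squeeze_lt fun i _ => digit_lt hn H i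

theorem slot_lt {p : ℕ} (hp : 0 < p) (k S i : ℕ) : slot p k S i < sketchBase p k :=
  digit_lt (sketchBase_pos hp k) S i

theorem digit_rebuilt {n k p H S i : ℕ} (hn : 0 < n) (hi : i < k) (hheavy : Heavy p k S i) (X : ℕ) :
    digit n (rebuilt n k p H S X) (Nat.count (Heavy p k S) i) = digit n H i :=
  digit_squeeze_add (fun i _ => digit_lt hn H i) X hi hheavy

namespace Represents

variable {n k p : ℕ} {E : Finset ℕ} {H S : ℕ}

theorem empty (n k p H : ℕ) : Represents n k p ∅ H 0 := ⟨rfl, by simp⟩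

theorem insert {e : ℕ} (h : Represents n k p E H S) (he : e ∉ E) (hhit : firstHit n e k H < k) :
    Represents n k p (insert e E) H (S + load n k p H e) where
  eq_loadSum := by rw [insert_val_of_notMem he, loadSum_cons, h.eq_loadSum, add_comm]
  firstHit_lt := forall_mem_insert _ _ _ |>.2 ⟨hhit, h.firstHit_lt⟩

theorem erase {e : ℕ} (h : Represents n k p E H S) (he : e ∈ E) :
    Represents n k p (E.erase e) H (S - load n k p H e) where
  eq_loadSum := by
    rw [h.eq_loadSum, ← insert_erase he, insert_val_of_notMem (notMem_erase e E), loadSum_cons,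
      Nat.add_sub_cancel_left, erase_insert (notMem_erase e E)]
  firstHit_lt a ha := h.firstHit_lt a (mem_of_mem_erase ha)

theorem slot_eq (h : Represents n k p E H S) (hp : 0 < p) (hE : #E ≤ p) {i : ℕ} (hi : i < k) :
    slot p k S i = sketchSum p (2 * k + 1) (star n k H E i).val := by
  rw [slot, h.eq_loadSum, loadSum_eq_sum_range]
  exact digit_sum_mul_pow (fun i _ => sketchSum_filter_lt hp hE i) (hi.trans k.lt_succ_self)

theorem heavy_iff (h : Represents n k p E H S) (hp : 1 < p) (hE : #E ≤ p) {i : ℕ} (hi : i < k) :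
    Heavy p k S i ↔ k < #(star n k H E i) := by
  rw [Heavy, h.slot_eq (by omega) hE hi, sketchSum_mod hp (2 * k).succ_pos]
  · rfl
  · exact (card_le_card (filter_subset _ E)).trans hE

theorem card_star_lightEdges_le (h : Represents n k p E H S) (hp : 1 < p) (hE : #E ≤ p) (i : ℕ) :
    #(star n k H (lightEdges n k p E H S) i) ≤ k := by
  by_cases hi : i < k ∧ ¬ Heavy p k S i
  · rw [h.heavy_iff hp hE hi.1, not_lt] at hi
    exact (card_le_card (filter_subset_filter _ (filter_subset _ _))).trans hi.2
  · rw [star, filter_eq_empty_iff.2, card_empty]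
    · exact k.zero_le
    · rintro e he rfl
      exact hi ⟨h.firstHit_lt e (filter_subset _ _ he), (mem_filter.1 he).2⟩

theorem card_lightEdges_le (h : Represents n k p E H S) (hp : 1 < p) (hE : #E ≤ p) :
    #(lightEdges n k p E H S) ≤ k * k := by
  have hmaps : ∀ e ∈ lightEdges n k p E H S, firstHit n e k H ∈ range k := fun e he =>
    mem_range.2 (h.firstHit_lt e (filter_subset _ _ he))
  simpa using card_le_mul_card_image_of_maps_to hmaps k fun i _ => h.card_star_lightEdges_le hp hE i

theorem lightSlots_eq (h : Represents n k p E H S) (hp : 0 < p) (hE : #E ≤ p) :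
    lightSlots k p S = loadSum n k p H (lightEdges n k p E H S).val := by
  rw [lightSlots, loadSum, lightEdges]
  refine (sum_congr rfl fun i hi => ?_).trans
    (sum_filter_not_eq_sum_range h.firstHit_lt (sketch p (2 * k + 1))).symm
  rw [h.slot_eq hp hE (mem_range.1 hi)]
  rfl

theorem firstHit_rebuilt (h : Represents n k p E H S) (hn : 0 < n) (X : ℕ) {e : ℕ}
    (he : e ∈ heavyEdges n k p E H S) :
    firstHit n e k (rebuilt n k p H S X) = Nat.count (Heavy p k S) (firstHit n e k H) := by
  obtain ⟨he, hheavy⟩ := mem_filter.1 he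
  have hlt := h.firstHit_lt e he
  refine firstHit_eq ((Nat.count_le _).trans_lt hlt) ?_ fun j hj => ?_
  · rw [Hit, digit_rebuilt hn hlt hheavy]
    exact hit_firstHit hlt
  · obtain ⟨i, hi, hheavy, rfl⟩ := exists_count_eq_of_lt_count hj
    rw [Hit, digit_rebuilt hn (hi.trans hlt) hheavy]
    exact not_hit_of_lt_firstHit hi

theorem heavySlots_eq (h : Represents n k p E H S) (hn : 0 < n) (hp : 0 < p) (hE : #E ≤ p) (X : ℕ) :
    heavySlots k p S =
      loadSum n k p (rebuilt n k p H S X) (heavyEdges n k p E H S).val := by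
  calc heavySlots k p S = ∑ e ∈ heavyEdges n k p E H S, sketch p (2 * k + 1) e *
        sketchBase p k ^ Nat.count (Heavy p k S) (firstHit n e k H) := by
        rw [heavyEdges, sum_filter_eq_squeeze h.firstHit_lt, heavySlots, squeeze, squeeze]
        refine sum_congr rfl fun i hi => ?_
        rw [h.slot_eq hp hE (mem_range.1 hi)]
        rfl
    _ = ∑ e ∈ heavyEdges n k p E H S, load n k p (rebuilt n k p H S X) e :=
        sum_congr rfl fun e he => by rw [load, h.firstHit_rebuilt hn X he]

theorem of_rebuilt (h : Represents n k p E H S) (hn : 0 < n) (hp : 1 < p) (hE : #E ≤ p) {e X : ℕ}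
    (he : e ∉ E) (hX : loadSum n k p (rebuilt n k p H S X)
      (e ::ₘ (lightEdges n k p E H S).val) < sketchBase p k ^ k) :
    Represents n k p (Insert.insert e E) (rebuilt n k p H S X)
      (heavySlots k p S +
        loadSum n k p (rebuilt n k p H S X) (e ::ₘ (lightEdges n k p E H S).val)) where
  eq_loadSum := by
    have heavy_add_light : (heavyEdges n k p E H S).val + (lightEdges n k p E H S).val = E.val :=
      Multiset.filter_add_not (fun e => Heavy p k S (firstHit n e k H)) E.val
    rw [h.heavySlots_eq hn (by omega) hE X, insert_val_of_notMem he, ← heavy_add_light]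
    simp only [loadSum, Multiset.map_cons, Multiset.map_add, Multiset.sum_cons, Multiset.sum_add]
    ring
  firstHit_lt a ha := by
    by_cases hheavy : a ∈ heavyEdges n k p E H S
    · rw [h.firstHit_rebuilt hn X hheavy]
      exact (Nat.count_le _).trans_lt (h.firstHit_lt a (filter_subset _ _ hheavy))
    · refine firstHit_lt_of_loadSum_lt hp hX (Multiset.mem_cons.2 ?_)
      exact (mem_insert.1 ha).imp_right fun ha =>
        mem_filter.2 ⟨ha, fun hstar => hheavy (mem_filter.2 ⟨ha, hstar⟩)⟩

/-- If the vertex were missing from the cover, then the other ends of the edges in its star would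
be more than `k` distinct vertices of the cover. -/
theorem digit_mem_of_heavy (h : Represents n k p E H S) (hp : 1 < p) (hE : #E ≤ p)
    (hcodes : IsCodes n E) {T : Finset ℕ} (hT : IsSmallCover n k T E) {i : ℕ} (hi : i < k)
    (hheavy : Heavy p k S i) : digit n H i ∈ T := by
  by_contra hmem
  have hstar : star n k H E i ⊆ T.image (edgeCode n (digit n H i)) := fun e he => by
    obtain ⟨heE, rfl⟩ := mem_filter.1 he
    rw [mem_image]
    have hcode := edgeCode_div_mod (hcodes e heE).2
    rcases hit_firstHit hi with hend | hend <;> rw [hend] at hmem ⊢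
    · exact ⟨_, (hT.covers e heE).resolve_left hmem, hcode⟩
    · exact ⟨_, (hT.covers e heE).resolve_right hmem, edgeCode_comm n _ _ ▸ hcode⟩
  exact ((h.heavy_iff hp hE hi).1 hheavy).not_ge
    ((card_le_card hstar).trans (card_image_le.trans hT.card_le))

theorem digit_injOn_heavy (h : Represents n k p E H S) (hp : 1 < p) (hE : #E ≤ p) :
    Set.InjOn (digit n H) ({i ∈ range k | Heavy p k S i} : Finset ℕ) := by
  have ne_of_lt {i j : ℕ} (hij : i < j) (hj : j < k) (hheavy : Heavy p k S j) :
      digit n H i ≠ digit n H j := fun heq => by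
    obtain ⟨e, he⟩ := card_pos.1 (Nat.zero_lt_of_lt ((h.heavy_iff hp hE hj).1 hheavy))
    obtain ⟨-, rfl⟩ := mem_filter.1 he
    exact not_hit_of_lt_firstHit hij (by simpa only [Hit, heq] using hit_firstHit hj)
  intro i hi j hj heq
  rw [mem_coe, mem_filter, mem_range] at hi hj
  rcases lt_trichotomy i j with hij | rfl | hji
  · exact absurd heq (ne_of_lt hij hj.1 hj.2)
  · rfl
  · exact absurd heq.symm (ne_of_lt hji hi.1 hi.2)

theorem exists_digits_rebuilt (h : Represents n k p E H S) (hn : 0 < n) (hp : 1 < p) (hE : #E ≤ p)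
    (hcodes : IsCodes n E) {T : Finset ℕ} (hT : IsSmallCover n k T E) :
    ∃ X < n ^ k, ∀ t ∈ T, ∃ j < k, digit n (rebuilt n k p H S X) j = t := by
  let V : Finset ℕ := {i ∈ range k | Heavy p k S i}.image (digit n H)
  have hVT : V ⊆ T := image_subset_iff.2 fun i hi =>
    h.digit_mem_of_heavy hp hE hcodes hT (mem_range.1 (mem_filter.1 hi).1) (mem_filter.1 hi).2
  have hV : #V = heavyCount k p S := by
    rw [card_image_of_injOn (h.digit_injOn_heavy hp hE), heavyCount, Nat.count_eq_card_filter_range]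
  have hcard : heavyCount k p S + #(T \ V) ≤ k := by
    rw [← hV, add_comm, card_sdiff_add_card_eq_card hVT]
    exact hT.card_le
  obtain ⟨X, hX, hdigit⟩ := exists_digits_of_finset (T \ V) fun t ht => hT.lt t (mem_sdiff.1 ht).1
  refine ⟨X, hX.trans_le (Nat.pow_le_pow_right hn (by omega)), fun t ht => ?_⟩
  by_cases htV : t ∈ V
  · obtain ⟨i, hi, rfl⟩ := mem_image.1 htV
    obtain ⟨hi, hheavy⟩ := mem_filter.1 hi
    rw [mem_range] at hi
    exact ⟨_, (Nat.count_le _).trans_lt hi, digit_rebuilt hn hi hheavy X⟩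
  · obtain ⟨j, hj, rfl⟩ := hdigit t (mem_sdiff.2 ⟨ht, htV⟩)
    exact ⟨_, by omega, digit_add_mul_pow_add (heavyVertices_lt hn k p H S) X j⟩

theorem exists_rebuilt (h : Represents n k p E H S) (hn : 0 < n) (hp : 1 < p) (hkp : k * k < p)
    (hE : #E ≤ p) (hcodes : IsCodes n E) {e : ℕ} {T : Finset ℕ}
    (hT : IsSmallCover n k T (Insert.insert e E)) :
    ∃ X < n ^ k, loadSum n k p (rebuilt n k p H S X)
      (e ::ₘ (lightEdges n k p E H S).val) < sketchBase p k ^ k := by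
  obtain ⟨X, hX, hdigit⟩ :=
    h.exists_digits_rebuilt hn hp hE hcodes (hT.subset (subset_insert e E))
  refine ⟨X, hX, loadSum_lt_of_forall_firstHit_lt (by omega) ?_ fun a ha => ?_⟩
  · rw [Multiset.card_cons, card_val]
    exact (h.card_lightEdges_le hp hE).trans_lt hkp
  · have ha : a ∈ Insert.insert e E :=
      mem_insert.2 ((Multiset.mem_cons.1 ha).imp_right fun ha => filter_subset _ _ ha)
    rcases hT.covers a ha with hend | hend <;> obtain ⟨j, hj, hdj⟩ := hdigit _ hend
    · exact (firstHit_le_of_hit (.inl hdj)).trans_lt hj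
    · exact (firstHit_le_of_hit (.inr hdj)).trans_lt hj

theorem eq_lightEdges (h : Represents n k p E H S) (hp : p.Prime) (hk : k < p) (hE : #E ≤ p)
    (hEp : ∀ e ∈ E, e < p) {m : Multiset ℕ} (hm : ∀ a ∈ m, a < p) (hc : m.card ≤ p)
    (heq : loadSum n k p H m = lightSlots k p S) : m = (lightEdges n k p E H S).val := by
  rw [h.lightSlots_eq hp.pos hE] at heq
  exact (multiset_eq_of_loadSum_eq hp hk (fun a ha => hEp a (filter_subset _ _ ha)) hm
    ((card_le_card (filter_subset _ _)).trans hE) hc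
    (fun i => h.card_star_lightEdges_le hp.one_lt hE i) heq.symm).symm

end Represents

/-! ### Executions over memories with bounded cells -/

theorem Op.size_val_le (o : Op) (a b : ℕ) : (o.val a b).size ≤ a.size + b.size + 1 := by
  rw [Nat.size_le]
  have ha : a < 2 ^ (a.size + b.size) :=
    a.lt_size_self.trans_le (Nat.pow_le_pow_right two_pos (Nat.le_add_right _ _))
  have hb : b < 2 ^ (a.size + b.size) :=
    b.lt_size_self.trans_le (Nat.pow_le_pow_right two_pos (Nat.le_add_left _ _))
  have hab : a * b < 2 ^ (a.size + b.size) :=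
    pow_add 2 a.size b.size ▸ Nat.mul_lt_mul'' a.lt_size_self b.lt_size_self
  rw [pow_succ]
  cases o with
  | add => exact (add_lt_add ha hb).trans_eq (mul_two _).symm
  | sub => exact (Nat.sub_le a b).trans_lt (by omega)
  | mul => exact hab.trans_le (by omega)
  | div => exact (Nat.div_le_self a b).trans_lt (by omega)
  | mod => exact (Nat.mod_le a b).trans_lt (by omega)
  | and => exact Nat.and_le_left.trans_lt (by omega)
  | xor => exact (Nat.xor_lt_two_pow ha hb).trans_le (by omega)
  | eq => rw [Op.val]; split_ifs <;> omega
  | lt => rw [Op.val]; split_ifs <;> omega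

/-- A coefficient bounding the size of the value and the cost of an expression, relative to the
number of bits of the cells. -/
def Expr.weight : Expr → ℕ
  | lit v => 1 + v.size
  | mem a => 2 * a.weight + 2
  | op _ a b => 3 * (a.weight + b.weight) + 2

theorem Expr.size_val_le_and_cost_le {B : ℕ} {M : ℕ →₀ ℕ} (hM : ∀ a, M a < 2 ^ B) (e : Expr) :
    (e.val M).size ≤ e.weight * (B + 1) ∧ e.cost M ≤ e.weight * (B + 1) := by
  induction e with
  | lit v =>
    simp only [val, cost, weight]
    constructor <;> nlinarith [Nat.zero_le (v.size * B)]
  | mem a ih =>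
    have hcell : (M (a.val M)).size ≤ B := Nat.size_le.2 (hM _)
    simp only [val, cost, weight]
    constructor <;> nlinarith [ih.1, ih.2]
  | op o a b iha ihb =>
    have hval := o.size_val_le (a.val M) (b.val M)
    simp only [val, cost, weight]
    constructor <;> nlinarith [iha.1, iha.2, ihb.1, ihb.2]

theorem Expr.cost_le {B w : ℕ} {M : ℕ →₀ ℕ} (hM : ∀ a, M a < 2 ^ B) {e : Expr}
    (hw : e.weight ≤ w) : e.cost M ≤ w * (B + 1) :=
  (e.size_val_le_and_cost_le hM).2.trans (Nat.mul_le_mul_right _ hw)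

/-- A coefficient bounding the cost of the single steps of a command, relative to the number of bits
of the cells. -/
def Cmd.weight : Cmd → ℕ
  | skip => 0
  | assign d e => d.weight + e.weight
  | flip d => d.weight + 1
  | emit e => e.weight
  | seq p q => max p.weight q.weight
  | ite e p q => max e.weight (max p.weight q.weight)
  | loop e p => max e.weight p.weight

/-- The cells that a command writes, as far as they are given by literal addresses. -/
def Cmd.targets : Cmd → List ℕ
  | assign (.lit a) _ => [a]
  | seq p q => p.targets ++ q.targets
  | ite _ p q => p.targets ++ q.targets
  | loop _ p => p.targets
  | _ => []

/-- All cells hold at most `B` bits, and only the first `r` cells are used. -/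
def Bounded (r B : ℕ) (M : ℕ →₀ ℕ) : Prop := (∀ a, M a < 2 ^ B) ∧ ∀ a, r ≤ a → M a = 0

/-- The number of bits used by a command of weight `w` on memories with `r` cells of `B` bits. -/
def spaceBound (r B w : ℕ) : ℕ := r * (r + B) + w * (B + 1)

namespace Bounded

variable {r B : ℕ} {M : ℕ →₀ ℕ}

theorem update (h : Bounded r B M) {a v : ℕ} (ha : a < r) (hv : v < 2 ^ B) :
    Bounded r B (M.update a v) := by
  refine ⟨fun b => ?_, fun b hb => ?_⟩ <;> rw [Finsupp.coe_update, Function.update_apply]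
  · split_ifs
    exacts [hv, h.1 b]
  · rw [if_neg (by omega), h.2 b hb]

theorem memBits_le (h : Bounded r B M) : memBits M ≤ r * (r + B) := by
  have hsupport : M.support ⊆ range r := fun a ha =>
    mem_range.2 <| lt_of_not_ge fun hr => Finsupp.mem_support_iff.1 ha (h.2 a hr)
  calc memBits M ≤ ∑ a ∈ range r, (a.size + (M a).size) := sum_le_sum_of_subset hsupport
    _ ≤ ∑ _a ∈ range r, (r + B) := sum_le_sum fun a ha =>
        Nat.add_le_add ((Nat.size_le.2 Nat.lt_two_pow_self).trans (mem_range.1 ha).le)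
          (Nat.size_le.2 (h.1 a))
    _ = r * (r + B) := by rw [sum_const, card_range, smul_eq_mul]

theorem memBits_le_spaceBound (h : Bounded r B M) (w : ℕ) : memBits M ≤ spaceBound r B w :=
  h.memBits_le.trans (Nat.le_add_right _ _)

end Bounded

/-- An execution of `n` steps, each of weight at most `w`, leads from the state `s` to the state `t`
over memories with `r` cells of `B` bits, and writes the output `o`. -/
structure Advance (r B w : ℕ) (s : State) (o : List ℕ) (n : ℕ) (t : State) : Prop where
  bounded : Bounded r B t.mem
  out_eq : t.out = s.out ++ o
  time_le : t.time ≤ s.time + n * (w * (B + 1))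
  peak_le : t.peak ≤ max s.peak (spaceBound r B w)

namespace Advance

variable {r B w : ℕ} {s t u : State}

theorem refl (h : Bounded r B s.mem) : Advance r B w s [] 0 s where
  bounded := h
  out_eq := (List.append_nil _).symm
  time_le := Nat.le_add_right _ _
  peak_le := le_max_left _ _

theorem trans {o o' : List ℕ} {n n' : ℕ} (h : Advance r B w s o n t)
    (h' : Advance r B w t o' n' u) : Advance r B w s (o ++ o') (n + n') u where
  bounded := h'.bounded
  out_eq := by rw [h'.out_eq, h.out_eq, List.append_assoc]
  time_le := by linarith [h.time_le, h'.time_le]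
  peak_le := h'.peak_le.trans (max_le h.peak_le (le_max_right _ _))

theorem charge (h : Bounded r B s.mem) {c : ℕ} (hc : c ≤ w * (B + 1)) :
    Advance r B w s [] 1 (s.charge c) where
  bounded := h
  out_eq := (List.append_nil _).symm
  time_le := by simpa [State.charge] using hc
  peak_le := max_le_max_left _ (Nat.add_le_add h.memBits_le hc)

theorem write (h : Bounded r B s.mem) {a v : ℕ} (ha : a < r) (hv : v < 2 ^ B) :
    Advance r B w s [] 0 (s.write a v) where
  bounded := h.update ha hv
  out_eq := (List.append_nil _).symm
  time_le := Nat.le_add_right _ _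
  peak_le := max_le_max_left _ ((h.update ha hv).memBits_le_spaceBound w)

theorem print (h : Bounded r B s.mem) (v : ℕ) : Advance r B w s [v] 0 (s.print v) where
  bounded := h
  out_eq := rfl
  time_le := Nat.le_add_right _ _
  peak_le := le_max_left _ _

end Advance

/-- `Ev B p M M' o t`: the command `p`, which uses no coins, turns the memory `M` into `M'` in `t`
steps, writes the output `o`, and stores only numbers below `2 ^ B`, at literal addresses. -/
inductive Ev (B : ℕ) : Cmd → (ℕ →₀ ℕ) → (ℕ →₀ ℕ) → List ℕ → ℕ → Prop
  | skip (M : ℕ →₀ ℕ) : Ev B .skip M M [] 0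
  | assign (a : ℕ) {e : Expr} {M : ℕ →₀ ℕ} : e.val M < 2 ^ B →
      Ev B (.assign (.lit a) e) M (M.update a (e.val M)) [] 1
  | emit (e : Expr) (M : ℕ →₀ ℕ) : Ev B (.emit e) M M [e.val M] 1
  | seq {p q : Cmd} {M M' M'' : ℕ →₀ ℕ} {o o' : List ℕ} {t t' : ℕ} :
      Ev B p M M' o t → Ev B q M' M'' o' t' → Ev B (.seq p q) M M'' (o ++ o') (t + t')
  | ite_true {e : Expr} {p q : Cmd} {M M' : ℕ →₀ ℕ} {o : List ℕ} {t : ℕ} :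
      e.val M ≠ 0 → Ev B p M M' o t → Ev B (.ite e p q) M M' o (1 + t)
  | ite_false {e : Expr} {p q : Cmd} {M M' : ℕ →₀ ℕ} {o : List ℕ} {t : ℕ} :
      e.val M = 0 → Ev B q M M' o t → Ev B (.ite e p q) M M' o (1 + t)
  | loop_true {e : Expr} {p : Cmd} {M M' M'' : ℕ →₀ ℕ} {o o' : List ℕ} {t t' : ℕ} :
      e.val M ≠ 0 → Ev B p M M' o t → Ev B (.loop e p) M' M'' o' t' →
      Ev B (.loop e p) M M'' (o ++ o') (1 + t + t')
  | loop_false {e : Expr} {p : Cmd} {M : ℕ →₀ ℕ} : e.val M = 0 → Ev B (.loop e p) M M [] 1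

namespace Ev

variable {B : ℕ} {p : Cmd} {M M' : ℕ →₀ ℕ} {o : List ℕ} {t : ℕ}

theorem exists_exec (h : Ev B p M M' o t) (ω : ℕ → Bool) {r w : ℕ} (hr : ∀ a ∈ p.targets, a < r)
    (hw : p.weight ≤ w) {s : State} (hM : Bounded r B s.mem) (hs : s.mem = M) :
    ∃ s', Exec ω p s s' ∧ s'.mem = M' ∧ Advance r B w s o t s' := by
  induction h generalizing s with
  | skip M => exact ⟨s, .skip s, hs, .refl hM⟩
  | assign a he =>
    subst hs
    have hcharge := Advance.charge hM <| (Nat.add_le_add (Expr.cost_le hM.1 (e := .lit a) le_rfl)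
      (Expr.cost_le hM.1 le_rfl)).trans ((add_mul _ _ _).symm.trans_le (Nat.mul_le_mul_right _ hw))
    exact ⟨_, .assign _ _ s, rfl,
      hcharge.trans (.write hcharge.bounded (hr a (List.mem_singleton_self a)) he)⟩
  | emit e M =>
    subst hs
    have hcharge := Advance.charge hM (Expr.cost_le hM.1 hw)
    exact ⟨_, .emit e s, rfl, hcharge.trans (.print hcharge.bounded _)⟩
  | seq _ _ ihp ihq =>
    rw [Cmd.targets, List.forall_mem_append] at hr
    obtain ⟨s', hp, hs', hadv⟩ := ihp hr.1 (le_of_max_le_left hw) hM hs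
    obtain ⟨s'', hq, hs'', hadv'⟩ := ihq hr.2 (le_of_max_le_right hw) hadv.bounded hs'
    exact ⟨s'', .seq hp hq, hs'', hadv.trans hadv'⟩
  | ite_true he _ ih =>
    subst hs
    rw [Cmd.targets, List.forall_mem_append] at hr
    rw [Cmd.weight, max_le_iff, max_le_iff] at hw
    have hcharge := Advance.charge hM (Expr.cost_le hM.1 hw.1)
    obtain ⟨s', hp, hs', hadv⟩ := ih hr.1 hw.2.1 hcharge.bounded rfl
    exact ⟨s', .ite_true he hp, hs', hcharge.trans hadv⟩
  | ite_false he _ ih =>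
    subst hs
    rw [Cmd.targets, List.forall_mem_append] at hr
    rw [Cmd.weight, max_le_iff, max_le_iff] at hw
    have hcharge := Advance.charge hM (Expr.cost_le hM.1 hw.1)
    obtain ⟨s', hq, hs', hadv⟩ := ih hr.2 hw.2.2 hcharge.bounded rfl
    exact ⟨s', .ite_false he hq, hs', hcharge.trans hadv⟩
  | loop_true he _ _ ihp ihloop =>
    subst hs
    have hcharge := Advance.charge hM (Expr.cost_le hM.1 (le_of_max_le_left hw))
    obtain ⟨s', hp, hs', hadv⟩ := ihp hr (le_of_max_le_right hw) hcharge.bounded rfl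
    obtain ⟨s'', hloop, hs'', hadv'⟩ := ihloop hr hw hadv.bounded hs'
    exact ⟨s'', .loop_true he hp hloop, hs'', (hcharge.trans hadv).trans hadv'⟩
  | loop_false he =>
    subst hs
    exact ⟨_, .loop_false he, rfl, .charge hM (Expr.cost_le hM.1 (le_of_max_le_left hw))⟩

theorem frame (h : Ev B p M M' o t) {a : ℕ} (ha : a ∉ p.targets) : M' a = M a := by
  induction h with
  | skip | emit | loop_false => rfl
  | assign b _ =>
    rw [Finsupp.coe_update, Function.update_of_ne fun hab => ha (List.mem_singleton.2 hab)]
  | seq _ _ ihp ihq =>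
    rw [Cmd.targets, List.mem_append, not_or] at ha
    rw [ihq ha.2, ihp ha.1]
  | ite_true _ _ ih => exact ih fun hp => ha (List.mem_append_left _ hp)
  | ite_false _ _ ih => exact ih fun hq => ha (List.mem_append_right _ hq)
  | loop_true _ _ _ ihp ihloop => rw [ihloop ha, ihp ha]

end Ev

/-! ### Programs and their total correctness -/

namespace Expr

/-- The content of the cell `a`. -/
def reg (a : ℕ) : Expr := .mem (.lit a)

instance : Add Expr := ⟨.op .add⟩
instance : Sub Expr := ⟨.op .sub⟩
instance : Mul Expr := ⟨.op .mul⟩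
instance : Div Expr := ⟨.op .div⟩
instance : Mod Expr := ⟨.op .mod⟩

variable (M : ℕ →₀ ℕ) (a b : Expr)

@[simp] theorem val_reg (c : ℕ) : (reg c).val M = M c := rfl
@[simp] theorem val_lit (c : ℕ) : (lit c).val M = c := rfl
@[simp] theorem val_add : (a + b).val M = a.val M + b.val M := rfl
@[simp] theorem val_sub : (a - b).val M = a.val M - b.val M := rfl
@[simp] theorem val_mul : (a * b).val M = a.val M * b.val M := rfl
@[simp] theorem val_div : (a / b).val M = a.val M / b.val M := rfl
@[simp] theorem val_mod : (a % b).val M = a.val M % b.val M := rfl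
@[simp] theorem val_eq : (op .eq a b).val M = if a.val M = b.val M then 1 else 0 := rfl
@[simp] theorem val_lt : (op .lt a b).val M = if a.val M < b.val M then 1 else 0 := rfl

theorem val_lt_ne_zero : (op .lt a b).val M ≠ 0 ↔ a.val M < b.val M := by simp

theorem val_lt_eq_zero : (op .lt a b).val M = 0 ↔ b.val M ≤ a.val M := by simp

theorem val_one_sub_eq_eq_zero : (lit 1 - op .eq a b).val M = 0 ↔ a.val M = b.val M := by
  by_cases h : a.val M = b.val M <;> simp [h]

theorem val_one_sub_lt_eq_zero : (lit 1 - op .lt a b).val M = 0 ↔ a.val M < b.val M := by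
  by_cases h : a.val M < b.val M <;> simp [h]

end Expr

/-- Store the value of `e` in the cell `a`. -/
def put (a : ℕ) (e : Expr) : Cmd := .assign (.lit a) e

local notation:62 a:63 "::=" e:63 => put a e
local notation:60 p:61 ";;" q:60 => Cmd.seq p q

open StreamRAM.Expr in
/-- Run `p` with the values `0, …, l - 1` in the cell `i`, where `l` is the value of a cell. -/
def forLoop (i l : ℕ) (p : Cmd) : Cmd :=
  i ::= lit 0 ;; .loop (op .lt (reg i) (reg l)) (p ;; i ::= reg i + lit 1)

open StreamRAM.Expr in
/-- Run `p` with the values `0, 1, …` in the cell `x`, until `e` becomes zero. -/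
def search (x : ℕ) (e : Expr) (p : Cmd) : Cmd :=
  (x ::= lit 0 ;; p) ;; .loop e (x ::= reg x + lit 1 ;; p)

/-- Started in the memory `M`, the command halts without output in a memory with the property `Q`,
and it stores only numbers below `2 ^ B`. -/
def WP (B : ℕ) (p : Cmd) (Q : (ℕ →₀ ℕ) → Prop) (M : ℕ →₀ ℕ) : Prop :=
  ∃ M' t, Ev B p M M' [] t ∧ Q M'

namespace WP

variable {B : ℕ} {p q : Cmd} {e : Expr} {P Q : (ℕ →₀ ℕ) → Prop} {M : ℕ →₀ ℕ}

theorem put {a : ℕ} (h : e.val M < 2 ^ B) (hQ : Q (M.update a (e.val M))) :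
    WP B (a ::= e) Q M := ⟨_, _, .assign a h, hQ⟩

theorem seq (h : WP B p (WP B q Q) M) : WP B (p ;; q) Q M := by
  obtain ⟨M', t, hp, M'', t', hq, hQ⟩ := h
  exact ⟨M'', _, .seq hp hq, hQ⟩

theorem put_seq {a : ℕ} (h : e.val M < 2 ^ B) (hQ : WP B q Q (M.update a (e.val M))) :
    WP B (a ::= e ;; q) Q M := seq (put h hQ)

theorem ite (hp : e.val M ≠ 0 → WP B p Q M) (hq : e.val M = 0 → WP B q Q M) :
    WP B (.ite e p q) Q M := by
  by_cases h : e.val M = 0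
  · obtain ⟨M', t, hq, hQ⟩ := hq h
    exact ⟨M', _, .ite_false h hq, hQ⟩
  · obtain ⟨M', t, hp, hQ⟩ := hp h
    exact ⟨M', _, .ite_true h hp, hQ⟩

theorem skip (h : Q M) : WP B .skip Q M := ⟨M, _, .skip M, h⟩

theorem imp (h : WP B p P M) (hPQ : ∀ M', (∀ a ∉ p.targets, M' a = M a) → P M' → Q M') :
    WP B p Q M := by
  obtain ⟨M', t, hp, hP⟩ := h
  exact ⟨M', t, hp, hPQ M' (fun a ha => hp.frame ha) hP⟩

theorem loop {I : ℕ → (ℕ →₀ ℕ) → Prop} {m : ℕ} (hinit : I m M)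
    (hstep : ∀ m M', (∀ a ∉ p.targets, M' a = M a) → I (m + 1) M' →
      e.val M' ≠ 0 ∧ WP B p (I m) M')
    (hexit : ∀ M', (∀ a ∉ p.targets, M' a = M a) → I 0 M' → e.val M' = 0 ∧ Q M') :
    WP B (.loop e p) Q M := by
  suffices key : ∀ m M', (∀ a ∉ p.targets, M' a = M a) → I m M' → WP B (.loop e p) Q M' from
    key m M (fun _ _ => rfl) hinit
  intro m
  induction m with
  | zero =>
    intro M' hframe hI
    obtain ⟨he, hQ⟩ := hexit M' hframe hI
    exact ⟨M', _, .loop_false he, hQ⟩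
  | succ m ih =>
    intro M' hframe hI
    obtain ⟨he, M'', t, hp, hI'⟩ := hstep m M' hframe hI
    obtain ⟨M₃, t', hloop, hQ⟩ := ih M'' (fun a ha => (hp.frame ha).trans (hframe a ha)) hI'
    exact ⟨M₃, _, .loop_true he hp hloop, hQ⟩

/-- The invariant speaks of the memory in which the next value of the counter is already stored. -/
theorem forLoop {i l m : ℕ} {I : ℕ → (ℕ →₀ ℕ) → Prop} (hl : l ∉ i :: p.targets)
    (hi : i ∉ p.targets) (hm : M l = m) (hB : m < 2 ^ B) (hinit : I 0 (M.update i 0))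
    (hstep : ∀ j < m, ∀ M', (∀ a ∉ i :: p.targets, M' a = M a) → M' i = j → I j M' →
      WP B p (fun M'' => I (j + 1) (M''.update i (j + 1))) M')
    (hexit : ∀ M', (∀ a ∉ i :: p.targets, M' a = M a) → I m M' → Q M') :
    WP B (forLoop i l p) Q M := by
  subst hm
  have frame_of {M' : ℕ →₀ ℕ} (h : ∀ a ∉ (p ;; i ::= .reg i + .lit 1).targets,
      M' a = M.update i 0 a) (a : ℕ) (ha : a ∉ i :: p.targets) : M' a = M a := by
    rw [h a (by simpa [Cmd.targets, StreamRAM.put, and_comm] using ha), Finsupp.coe_update,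
      Function.update_of_ne (List.ne_of_not_mem_cons ha)]
  refine put_seq (by simp) (loop (m := M l)
    (I := fun m M' => ∃ j, j + m = M l ∧ M' i = j ∧ I j M') ⟨0, by simpa using hinit⟩
    (fun m M' hframe => ?_) fun M' hframe => ?_)
  · rintro ⟨j, hj, hij, hI⟩
    have hM' := frame_of hframe
    refine ⟨(Expr.val_lt_ne_zero _ _ _).2 (by simp [hM' l hl]; omega), seq <|
      (hstep j (by omega) M' hM' hij hI).imp fun M'' hframe' hI' => put ?_ ?_⟩
    · simp [hframe' i hi, hij]; omega
    · refine ⟨j + 1, by omega, by simp [hframe' i hi, hij], ?_⟩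
      simpa [hframe' i hi, hij] using hI'
  · rintro ⟨j, hj, hij, hI⟩
    have hM' := frame_of hframe
    exact ⟨(Expr.val_lt_eq_zero _ _ _).2 (by simp [hM' l hl]; omega), hexit M' hM' (hj ▸ hI)⟩

theorem search {x N : ℕ} {good : ℕ → Prop} {R : ℕ → (ℕ →₀ ℕ) → Prop} (hx : x ∉ p.targets)
    (hN : good N) (hB : N < 2 ^ B)
    (hbody : ∀ j ≤ N, ∀ M', (∀ a ∉ x :: p.targets, M' a = M a) → M' x = j →
      WP B p (fun M'' => (e.val M'' = 0 ↔ good j) ∧ R j M'') M')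
    (hexit : ∀ j ≤ N, good j → ∀ M', (∀ a ∉ x :: p.targets, M' a = M a) → M' x = j → R j M' →
      Q M') :
    WP B (search x e p) Q M := by
  classical
  obtain ⟨m, hm, hmN, hmin⟩ : ∃ m, good m ∧ m ≤ N ∧ ∀ j < m, ¬ good j :=
    ⟨Nat.find ⟨N, hN⟩, Nat.find_spec _, Nat.find_min' _ hN, fun j => Nat.find_min _⟩
  let I (r : ℕ) (M' : ℕ →₀ ℕ) : Prop := (∀ a ∉ x :: p.targets, M' a = M a) ∧
    ∃ j, j + r = m ∧ M' x = j ∧ (e.val M' = 0 ↔ good j) ∧ R j M'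
  have put_body {M' : ℕ →₀ ℕ} {e' : Expr} {j r : ℕ} (hM' : ∀ a ∉ x :: p.targets, M' a = M a)
      (he' : e'.val M' = j) (hjr : j + r = m) : WP B (x ::= e' ;; p) (I r) M' := by
    refine put_seq (by omega) ((hbody j (by omega) _ (fun a ha => ?_) (by simp [he'])).imp
      fun M'' hframe ⟨hgood, hR⟩ => ⟨fun a ha => ?_, j, hjr, ?_, hgood, hR⟩)
    · rw [Finsupp.coe_update, Function.update_of_ne (List.ne_of_not_mem_cons ha), hM' a ha]
    · rw [hframe a (List.not_mem_of_not_mem_cons ha), Finsupp.coe_update,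
        Function.update_of_ne (List.ne_of_not_mem_cons ha), hM' a ha]
    · simp [hframe x hx, he']
  have hinit : WP B (x ::= .lit 0 ;; p) (I m) M :=
    put_body (fun _ _ => rfl) (Expr.val_lit M 0) (zero_add m)
  refine seq (hinit.imp fun M₀ _ hI₀ => loop hI₀ ?_ ?_)
  · rintro r M' _ ⟨hM', j, hjr, hj, hgood, -⟩
    exact ⟨fun he => hmin j (by omega) (hgood.1 he),
      put_body (j := j + 1) hM' (by simp [hj]) (by omega)⟩
  · rintro M' _ ⟨hM', j, rfl, hj, hgood, hR⟩
    exact ⟨hgood.2 hm, hexit j hmN hm M' hM' hj hR⟩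

end WP

/-! ### Evaluation of the sketches of a list of edges -/

-- The cells 0 to 5 are those filled by `startState` and `State.feed`.
local notation "cell_n" => (0 : ℕ)
local notation "cell_k" => (1 : ℕ)
local notation "cell_ins" => (3 : ℕ)
local notation "cell_u" => (4 : ℕ)
local notation "cell_v" => (5 : ℕ)
local notation "cell_N" => (6 : ℕ)
local notation "cell_p" => (7 : ℕ)
local notation "cell_Q" => (8 : ℕ)
local notation "cell_Z" => (9 : ℕ)
local notation "cell_Zk" => (10 : ℕ)
local notation "cell_H" => (11 : ℕ)
local notation "cell_S" => (12 : ℕ)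
local notation "cell_Y" => (13 : ℕ)
local notation "cell_G" => (14 : ℕ)
local notation "cell_acc" => (15 : ℕ)
local notation "cell_T" => (16 : ℕ)
local notation "cell_e" => (17 : ℕ)
local notation "cell_i" => (18 : ℕ)
local notation "cell_U" => (19 : ℕ)
local notation "cell_z" => (20 : ℕ)
local notation "cell_F" => (21 : ℕ)
local notation "cell_w" => (22 : ℕ)
local notation "cell_q" => (23 : ℕ)
local notation "cell_r" => (24 : ℕ)
local notation "cell_R" => (25 : ℕ)
local notation "cell_edge" => (26 : ℕ)
local notation "cell_j" => (27 : ℕ)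
local notation "cell_heavyH" => (28 : ℕ)
local notation "cell_heavyS" => (29 : ℕ)
local notation "cell_lightS" => (30 : ℕ)
local notation "cell_pn" => (31 : ℕ)
local notation "cell_pz" => (32 : ℕ)
local notation "cell_qz" => (33 : ℕ)
local notation "cell_restS" => (34 : ℕ)
local notation "cell_restH" => (35 : ℕ)
local notation "cell_X" => (36 : ℕ)

/-- Assumptions on the parameters: the prime `p` exceeds the codes of edges, and `B` bits suffice
for all numbers that occur. -/
structure Params (n k p B : ℕ) : Prop where
  two_le : 2 ≤ n
  k_le : k ≤ n
  prime : p.Prime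
  le_p : n * n + 2 ≤ p
  lt_pow : sketchBase p k ^ (k + 3) < 2 ^ B

theorem le_sketchBase (p k : ℕ) : p ≤ sketchBase p k :=
  (Nat.le_mul_self p).trans (Nat.le_self_pow (Nat.succ_ne_zero _) _)

theorem lt_of_le_sketchBase_pow {p k B x j : ℕ} (hp : 0 < p)
    (hB : sketchBase p k ^ (k + 3) < 2 ^ B) (hx : x ≤ sketchBase p k ^ j) (hj : j ≤ k + 3) :
    x < 2 ^ B :=
  (hx.trans (Nat.pow_le_pow_right (sketchBase_pos hp k) hj)).trans_lt hB

namespace Params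

variable {n k p B x : ℕ}

theorem one_lt_p (h : Params n k p B) : 1 < p := h.prime.one_lt

theorem base_pos (h : Params n k p B) : 0 < sketchBase p k := sketchBase_pos h.prime.pos k

theorem sq_lt_p (h : Params n k p B) : k * k + 1 < p := by
  linarith [Nat.mul_le_mul h.k_le h.k_le, h.le_p]

theorem k_lt_p (h : Params n k p B) : k < p := by linarith [h.sq_lt_p, k.le_mul_self]

theorem sq_le_base (h : Params n k p B) : n * n ≤ sketchBase p k := by
  linarith [h.le_p, le_sketchBase p k]

theorem n_le_base (h : Params n k p B) : n ≤ sketchBase p k := n.le_mul_self.trans h.sq_le_base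

theorem lt_of_le_pow (h : Params n k p B) {j : ℕ} (hx : x ≤ sketchBase p k ^ j) (hj : j ≤ k + 3) :
    x < 2 ^ B :=
  lt_of_le_sketchBase_pow h.prime.pos h.lt_pow hx hj

theorem lt_of_le_base (h : Params n k p B) (hx : x ≤ sketchBase p k) : x < 2 ^ B :=
  h.lt_of_le_pow (j := 1) (by rwa [pow_one]) (Nat.le_add_left 1 (k + 2))

theorem lt_of_le_p (h : Params n k p B) (hx : x ≤ p) : x < 2 ^ B :=
  h.lt_of_le_base (hx.trans (le_sketchBase p k))

theorem zero_lt (h : Params n k p B) : 0 < 2 ^ B := h.lt_of_le_p p.zero_le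

theorem one_lt (h : Params n k p B) : 1 < 2 ^ B := h.lt_of_le_p h.one_lt_p.le

theorem lt_of_le_list (h : Params n k p B) (hx : x ≤ (n * n) ^ (k * k + 1)) : x < 2 ^ B := by
  refine h.lt_of_le_pow (j := k + 3) ?_ le_rfl
  calc x ≤ p ^ (k * k + 1) := hx.trans (Nat.pow_le_pow_left (by linarith [h.le_p]) _)
    _ ≤ p ^ (2 * (2 * k + 1) * (k + 3)) := Nat.pow_le_pow_right h.prime.pos (by nlinarith)
    _ = sketchBase p k ^ (k + 3) := by rw [sketchBase, ← pow_two, ← pow_mul, ← pow_mul, mul_assoc]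

end Params

/-- The cells that hold the parameters. -/
def paramCells : List ℕ := [cell_n, cell_k, cell_N, cell_p, cell_Q, cell_Z, cell_Zk]

/-- The parameters are stored in their cells. -/
structure Ready (n k p : ℕ) (M : ℕ →₀ ℕ) : Prop where
  hn : M cell_n = n
  hk : M cell_k = k
  hN : M cell_N = n * n
  hp : M cell_p = p
  hQ : M cell_Q = p * p
  hZ : M cell_Z = sketchBase p k
  hZk : M cell_Zk = sketchBase p k ^ k

theorem update_frame (M : ℕ →₀ ℕ) (a v : ℕ) : ∀ b ∉ [a], M.update a v b = M b := fun b hb => by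
  rw [Finsupp.coe_update, Function.update_of_ne (List.ne_of_not_mem_cons hb)]

namespace Ready

variable {n k p : ℕ} {M M' : ℕ →₀ ℕ}

theorem frame (h : Ready n k p M) {L : List ℕ} (hf : ∀ a ∉ L, M' a = M a)
    (hL : ∀ a ∈ paramCells, a ∉ L := by decide) : Ready n k p M' where
  hn := (hf _ (hL _ (by decide))).trans h.hn
  hk := (hf _ (hL _ (by decide))).trans h.hk
  hN := (hf _ (hL _ (by decide))).trans h.hN
  hp := (hf _ (hL _ (by decide))).trans h.hp
  hQ := (hf _ (hL _ (by decide))).trans h.hQ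
  hZ := (hf _ (hL _ (by decide))).trans h.hZ
  hZk := (hf _ (hL _ (by decide))).trans h.hZk

theorem update (h : Ready n k p M) {a v : ℕ} (ha : a ∉ paramCells := by decide) :
    Ready n k p (M.update a v) :=
  h.frame (update_frame M a v) fun _ hb hab => ha (List.mem_singleton.1 hab ▸ hb)

end Ready

open StreamRAM.Expr in
/-- Compute the sketch of `e`. -/
def sketchCmd : Cmd :=
  cell_F ::= lit 0 ;; cell_w ::= lit 1 ;; cell_q ::= lit 1 ;;
  cell_R ::= reg cell_k + reg cell_k + lit 1 ;;
  forLoop cell_r cell_R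
    (cell_F ::= reg cell_F + reg cell_w * reg cell_q ;;
      cell_w ::= reg cell_w * reg cell_e % reg cell_p ;;
      cell_q ::= reg cell_q * reg cell_Q)

open StreamRAM.Expr in
/-- Compute the power of `Z` whose exponent is the index of the first vertex of `G` that is an end
of `e`. -/
def findCmd : Cmd :=
  cell_i ::= lit 0 ;; cell_U ::= reg cell_G ;; cell_z ::= lit 1 ;;
  .loop (op .lt (reg cell_i) (reg cell_k) *
      ((lit 1 - op .eq (reg cell_U % reg cell_n) (reg cell_e / reg cell_n)) *
        (lit 1 - op .eq (reg cell_U % reg cell_n) (reg cell_e % reg cell_n))))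
    (cell_U ::= reg cell_U / reg cell_n ;;
      cell_z ::= reg cell_z * reg cell_Z ;;
      cell_i ::= reg cell_i + lit 1)

open StreamRAM.Expr in
/-- Remove the first edge from the list `T`, and add its load to `acc`. -/
def loadStep : Cmd :=
  cell_e ::= reg cell_T % reg cell_N ;;
  cell_T ::= reg cell_T / reg cell_N ;;
  findCmd ;; sketchCmd ;;
  cell_acc ::= reg cell_acc + reg cell_F * reg cell_z

open StreamRAM.Expr in
/-- Add up the loads of the edges in the list `Y` with respect to the list of vertices `G`. -/
def loadCmd : Cmd :=
  cell_T ::= reg cell_Y ;; cell_acc ::= lit 0 ;;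
  .loop (reg cell_T) loadStep

/-- The multiset of the edges in the list `Y`, packed in base `n * n`. A list ends with its last
nonzero entry, since `0` is not the code of an edge. -/
def edgesOf (n Y : ℕ) : Multiset ℕ := (Nat.digits (n * n) Y : Multiset ℕ)

section EdgesOf

variable {n Y : ℕ}

theorem card_edgesOf_le {l : ℕ} (hn : 2 ≤ n) (hY : Y < (n * n) ^ l) : (edgesOf n Y).card ≤ l := by
  simpa [edgesOf] using (Nat.digits_length_le_iff (by nlinarith) Y).2 hY

theorem edgesOf_zero (n : ℕ) : edgesOf n 0 = 0 := by simp [edgesOf]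

theorem edgesOf_of_ne_zero (hn : 2 ≤ n) (hY : Y ≠ 0) :
    edgesOf n Y = (Y % (n * n)) ::ₘ edgesOf n (Y / (n * n)) := by
  rw [edgesOf, Nat.digits_def' (by nlinarith) (by omega)]
  rfl

end EdgesOf

section Specs

variable {n k p B : ℕ} {M : ℕ →₀ ℕ}

theorem sketchCmd_spec (hP : Params n k p B) (hM : Ready n k p M) :
    WP B sketchCmd (fun M' => M' cell_F = sketch p (2 * k + 1) (M cell_e)) M := by
  have hR : k + k + 1 < 2 ^ B := hP.lt_of_le_p (by nlinarith [hP.two_le, hP.k_le, hP.le_p])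
  refine .put_seq hP.zero_lt <| .put_seq hP.one_lt <| .put_seq hP.one_lt <|
    .put_seq (by simpa [hM.hk] using hR) <| .forLoop (m := 2 * k + 1)
      (I := fun j M' => M' cell_F = sketch p j (M cell_e) ∧ M' cell_w = M cell_e ^ j % p ∧
        M' cell_q = (p * p) ^ j) (by decide) (by decide) (by simp [hM.hk, two_mul])
      (by rwa [two_mul]) (by simp [sketch, Nat.mod_eq_of_lt hP.one_lt_p]) ?_
      fun M' _ h => h.1
  rintro j hj M' hf - ⟨hF, hw, hq⟩
  have hM' : Ready n k p M' := hM.update.update.update.update.frame hf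
  have he : M' cell_e = M cell_e := by simp [hf cell_e (by decide)]
  have hpow : (p * p) ^ (j + 1) ≤ sketchBase p k :=
    Nat.pow_le_pow_right (mul_pos hP.prime.pos hP.prime.pos) hj
  have hF' : M' cell_F + M' cell_w * M' cell_q = sketch p (j + 1) (M cell_e) := by
    rw [hF, hw, hq, sketch, sketch, sum_range_succ]
  have hw' : M' cell_w * M cell_e % p = M cell_e ^ (j + 1) % p := by
    rw [hw, pow_succ, Nat.mod_mul_mod]
  have hq' : M' cell_q * (p * p) = (p * p) ^ (j + 1) := by rw [hq, pow_succ]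
  refine .put_seq ?_ <| .put_seq ?_ <| .put ?_ ?_
  · simpa [hF'] using hP.lt_of_le_base ((sketch_lt hP.prime.pos _).le.trans hpow)
  · simpa [hM'.hp] using hP.lt_of_le_p (Nat.mod_lt _ hP.prime.pos).le
  · simpa [hM'.hQ, hq'] using hP.lt_of_le_base hpow
  · simp [hF', he, hM'.hp, hw', hM'.hQ, hq']

theorem findCmd_spec (hP : Params n k p B) (hM : Ready n k p M) (hG : M cell_G < 2 ^ B) :
    WP B findCmd
      (fun M' => M' cell_z = sketchBase p k ^ firstHit n (M cell_e) k (M cell_G)) M := by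
  have hle := firstHit_le n (M cell_e) k (M cell_G)
  refine .put_seq hP.zero_lt <| .put_seq (by simpa) <| .put_seq hP.one_lt <| .loop
    (m := firstHit n (M cell_e) k (M cell_G))
    (I := fun m M' => M' cell_i + m = firstHit n (M cell_e) k (M cell_G) ∧
      M' cell_U = M cell_G / n ^ M' cell_i ∧ M' cell_z = sketchBase p k ^ M' cell_i)
    (by simp) ?_ ?_
  · rintro m M' hf ⟨hi, hU, hz⟩
    have hM' : Ready n k p M' := hM.update.update.update.frame hf
    have he : M' cell_e = M cell_e := by simp [hf cell_e (by decide)]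
    have hmiss : ¬ Hit n (M cell_e) (M cell_G) (M' cell_i) :=
      not_hit_of_lt_firstHit (k := k) (by omega)
    rw [Hit, not_or, digit, ← hU] at hmiss
    refine ⟨by simp [hM'.hk, hM'.hn, he, hmiss.1, hmiss.2, show M' cell_i < k by omega],
      .put_seq ?_ <| .put_seq ?_ <| .put ?_ ⟨?_, ?_, ?_⟩⟩
    · simpa [hU] using ((Nat.div_le_self _ _).trans (Nat.div_le_self _ _)).trans_lt hG
    · simpa [hz, hM'.hZ, ← pow_succ] using hP.lt_of_le_pow le_rfl (by omega)
    · simpa using hP.lt_of_le_p (by linarith [hP.k_lt_p])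
    · simp; omega
    · simp [hU, hM'.hn, Nat.div_div_eq_div_mul, pow_succ]
    · simp [hz, hM'.hZ, pow_succ]
  · rintro M' hf ⟨hi, hU, hz⟩
    have hM' : Ready n k p M' := hM.update.update.update.frame hf
    have he : M' cell_e = M cell_e := by simp [hf cell_e (by decide)]
    rw [add_zero] at hi
    refine ⟨?_, hi ▸ hz⟩
    rcases hle.lt_or_eq with hlt | heq
    · have hhit := hit_firstHit hlt
      rw [Hit, digit, ← hi, ← hU] at hhit
      rcases hhit with h | h <;> simp [hM'.hn, he, h]
    · simp [hM'.hk, hi, heq]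

theorem loadSum_edgesOf_lt (hP : Params n k p B) {Y : ℕ} (hY : Y < (n * n) ^ (k * k + 1)) (G : ℕ) :
    loadSum n k p G (edgesOf n Y) < 2 ^ B := by
  refine hP.lt_of_le_pow (j := k + 2) ((loadSum_le hP.prime.pos _).trans ?_) (Nat.le_succ _)
  rw [pow_succ' _ (k + 1)]
  exact Nat.mul_le_mul_right _ <|
    (card_edgesOf_le hP.two_le hY).trans (hP.sq_lt_p.le.trans (le_sketchBase p k))

theorem loadStep_spec (hP : Params n k p B) (hM : Ready n k p M) (hG : M cell_G < 2 ^ B)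
    (hT : M cell_T < 2 ^ B)
    (hacc : M cell_acc + load n k p (M cell_G) (M cell_T % (n * n)) < 2 ^ B) :
    WP B loadStep (fun M' => M' cell_T = M cell_T / (n * n) ∧
      M' cell_acc = M cell_acc + load n k p (M cell_G) (M cell_T % (n * n))) M := by
  have hTmod : M cell_T % (n * n) < 2 ^ B := (Nat.mod_le _ _).trans_lt hT
  have hTdiv : M cell_T / (n * n) < 2 ^ B := (Nat.div_le_self _ _).trans_lt hT
  refine .put_seq (by simpa [hM.hN]) <| .put_seq (by simpa [hM.hN]) <| .seq <|
    (findCmd_spec hP hM.update.update (by simpa)).imp fun M₂ hf₂ hz => .seq <|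
    (sketchCmd_spec hP (hM.update.update.frame hf₂)).imp fun M₃ hf₃ hF => ?_
  have hload : M₃ cell_F * M₃ cell_z = load n k p (M cell_G) (M cell_T % (n * n)) := by
    rw [hF, hf₃ cell_z (by decide), hz, hf₂ cell_e (by decide), load]
    simp [hM.hN]
  have hacc' : M₃ cell_acc = M cell_acc := by
    rw [hf₃ _ (by decide), hf₂ _ (by decide)]
    simp
  have hT' : M₃ cell_T = M cell_T / (n * n) := by
    rw [hf₃ _ (by decide), hf₂ _ (by decide)]
    simp [hM.hN]
  exact .put (by simpa [hload, hacc'] using hacc) (by simp [hload, hacc', hT'])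

theorem loadCmd_spec (hP : Params n k p B) (hM : Ready n k p M)
    (hG : M cell_G < 2 ^ B) (hY : M cell_Y < (n * n) ^ (k * k + 1)) :
    WP B loadCmd
      (fun M' => M' cell_acc = loadSum n k p (M cell_G) (edgesOf n (M cell_Y))) M := by
  have hYB : M cell_Y < 2 ^ B := hP.lt_of_le_list hY.le
  have htotal := loadSum_edgesOf_lt hP hY (M cell_G)
  refine .put_seq (by simpa) <| .put_seq hP.zero_lt <| .loop
    (m := (edgesOf n (M cell_Y)).card)
    (I := fun m M' => m = (edgesOf n (M' cell_T)).card ∧ M' cell_T < 2 ^ B ∧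
      M' cell_acc + loadSum n k p (M cell_G) (edgesOf n (M' cell_T)) =
        loadSum n k p (M cell_G) (edgesOf n (M cell_Y))) (by simpa) ?_ ?_
  · rintro m M' hf ⟨hm, hT, hacc⟩
    have hG' : M' cell_G = M cell_G := by simp [hf cell_G (by decide)]
    have hne : M' cell_T ≠ 0 := fun h => by simp [h, edgesOf_zero] at hm
    rw [edgesOf_of_ne_zero hP.two_le hne, loadSum_cons, ← add_assoc] at hacc
    refine ⟨hne, (loadStep_spec hP (hM.update.update.frame hf) (hG' ▸ hG) hT
      (by rw [hG']; omega)).imp fun M'' _ ⟨hT', hacc'⟩ => ⟨?_, ?_, ?_⟩⟩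
    · rw [edgesOf_of_ne_zero hP.two_le hne, Multiset.card_cons] at hm
      rw [hT']
      omega
    · exact hT' ▸ (Nat.div_le_self _ _).trans_lt hT
    · rw [hacc', hT', hG', hacc]
  · rintro M' - ⟨hm, -, hacc⟩
    have hzero : M' cell_T = 0 := by
      by_contra hne
      simp [edgesOf_of_ne_zero hP.two_le hne] at hm
    exact ⟨hzero, by simpa [hzero, edgesOf_zero, loadSum] using hacc⟩

end Specs

/-! ### Separation of the heavy stars from the light ones -/

open StreamRAM.Expr in
/-- Keep the star that is read, and its vertex. -/
def heavyCmd : Cmd :=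
  cell_heavyH ::= reg cell_heavyH + reg cell_restH % reg cell_n * reg cell_pn ;;
  cell_heavyS ::= reg cell_heavyS + reg cell_restS % reg cell_Z * reg cell_pz ;;
  cell_pn ::= reg cell_pn * reg cell_n ;;
  cell_pz ::= reg cell_pz * reg cell_Z

open StreamRAM.Expr in
/-- Add the star that is read to the light ones. -/
def lightCmd : Cmd :=
  cell_lightS ::= reg cell_lightS + reg cell_restS % reg cell_Z * reg cell_qz

open StreamRAM.Expr in
/-- Go on to the next star. -/
def nextCmd : Cmd :=
  cell_qz ::= reg cell_qz * reg cell_Z ;;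
  cell_restS ::= reg cell_restS / reg cell_Z ;;
  cell_restH ::= reg cell_restH / reg cell_n

open StreamRAM.Expr in
/-- Separate the heavy stars from the light ones. -/
def separateCmd : Cmd :=
  cell_heavyH ::= lit 0 ;; cell_heavyS ::= lit 0 ;; cell_lightS ::= lit 0 ;;
  cell_pn ::= lit 1 ;; cell_pz ::= lit 1 ;; cell_qz ::= lit 1 ;;
  cell_restS ::= reg cell_S ;; cell_restH ::= reg cell_H ;;
  forLoop cell_j cell_k
    (.ite (op .lt (reg cell_k) (reg cell_restS % reg cell_Z % reg cell_Q)) heavyCmd lightCmd ;;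
      nextCmd)

/-- The first `j` stars have been separated. -/
structure Separated (n k p H S j : ℕ) (M : ℕ →₀ ℕ) : Prop where
  heavyH_eq : M cell_heavyH = squeeze (Heavy p k S) n (digit n H) j
  heavyS_eq : M cell_heavyS = squeeze (Heavy p k S) (sketchBase p k) (slot p k S) j
  lightS_eq : M cell_lightS =
    ∑ i ∈ range j, if Heavy p k S i then 0 else slot p k S i * sketchBase p k ^ i
  pn_eq : M cell_pn = n ^ Nat.count (Heavy p k S) j
  pz_eq : M cell_pz = sketchBase p k ^ Nat.count (Heavy p k S) j

/-- The star with index `j` is the next one to be read. -/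
structure Unread (n k p H S j : ℕ) (M : ℕ →₀ ℕ) : Prop where
  qz_eq : M cell_qz = sketchBase p k ^ j
  restS_eq : M cell_restS = S / sketchBase p k ^ j
  restH_eq : M cell_restH = H / n ^ j

section Separate

variable {n k p B H S j : ℕ} {M : ℕ →₀ ℕ}

theorem Params.lt_of_le_pow_of_le (hP : Params n k p B) {b x : ℕ} (hb : b ≤ sketchBase p k)
    (hx : x ≤ b ^ j) (hj : j ≤ k + 3) : x < 2 ^ B :=
  hP.lt_of_le_pow (hx.trans (Nat.pow_le_pow_left hb j)) hj

theorem Unread.slot_eq (h : Unread n k p H S j M) :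
    M cell_restS % sketchBase p k = slot p k S j := by rw [h.restS_eq, slot, digit]

theorem Unread.digit_eq (h : Unread n k p H S j M) : M cell_restH % n = digit n H j := by
  rw [h.restH_eq, digit]

theorem heavyCmd_spec (hP : Params n k p B) (hM : Ready n k p M)
    (hsep : Separated n k p H S j M) (hrest : Unread n k p H S j M) (hj : j < k)
    (hheavy : Heavy p k S j) : WP B heavyCmd (Separated n k p H S (j + 1)) M := by
  have hcount : Nat.count (Heavy p k S) (j + 1) = Nat.count (Heavy p k S) j + 1 := by
    rw [Nat.count_succ, if_pos hheavy]
  have hcount_le : Nat.count (Heavy p k S) (j + 1) ≤ k + 3 := by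
    linarith [Nat.count_le (p := Heavy p k S) (n := j + 1)]
  have hH : M cell_heavyH + digit n H j * M cell_pn =
      squeeze (Heavy p k S) n (digit n H) (j + 1) := by
    rw [squeeze_succ_of_pos hheavy, hsep.heavyH_eq, hsep.pn_eq]
  have hS : M cell_heavyS + slot p k S j * M cell_pz =
      squeeze (Heavy p k S) (sketchBase p k) (slot p k S) (j + 1) := by
    rw [squeeze_succ_of_pos hheavy, hsep.heavyS_eq, hsep.pz_eq]
  have hpn : M cell_pn * n = n ^ Nat.count (Heavy p k S) (j + 1) := by
    rw [hsep.pn_eq, hcount, pow_succ]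
  have hpz : M cell_pz * sketchBase p k = sketchBase p k ^ Nat.count (Heavy p k S) (j + 1) := by
    rw [hsep.pz_eq, hcount, pow_succ]
  have hH_lt := squeeze_lt (P := Heavy p k S) (b := n) (k := j + 1) fun i _ =>
    digit_lt (by linarith [hP.two_le]) H i
  have hS_lt := squeeze_lt (P := Heavy p k S) (k := j + 1) fun i _ => slot_lt hP.prime.pos k S i
  refine .put_seq ?_ <| .put_seq ?_ <| .put_seq ?_ <| .put ?_ ⟨?_, ?_, ?_, ?_, ?_⟩
  · simpa [hM.hn, hrest.digit_eq, hH] using hP.lt_of_le_pow_of_le hP.n_le_base hH_lt.le hcount_le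
  · simpa [hM.hZ, hrest.slot_eq, hS] using hP.lt_of_le_pow hS_lt.le hcount_le
  · simpa [hM.hn, hpn] using hP.lt_of_le_pow_of_le hP.n_le_base le_rfl hcount_le
  · simpa [hM.hZ, hpz] using hP.lt_of_le_pow le_rfl hcount_le
  · simp [hM.hn, hrest.digit_eq, hH]
  · simp [hM.hZ, hrest.slot_eq, hS]
  · simp [hsep.lightS_eq, sum_range_succ, hheavy]
  · simp [hM.hn, hpn]
  · simp [hM.hZ, hpz]

theorem lightCmd_spec (hP : Params n k p B) (hM : Ready n k p M)
    (hsep : Separated n k p H S j M) (hrest : Unread n k p H S j M) (hj : j < k)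
    (hlight : ¬ Heavy p k S j) : WP B lightCmd (Separated n k p H S (j + 1)) M := by
  have hcount : Nat.count (Heavy p k S) (j + 1) = Nat.count (Heavy p k S) j := by
    rw [Nat.count_succ, if_neg hlight, add_zero]
  have hS : M cell_lightS + slot p k S j * M cell_qz =
      ∑ i ∈ range (j + 1), if Heavy p k S i then 0 else slot p k S i * sketchBase p k ^ i := by
    rw [sum_range_succ, if_neg hlight, hsep.lightS_eq, hrest.qz_eq]
  have hS_lt : M cell_lightS + slot p k S j * M cell_qz < sketchBase p k ^ (j + 1) := by
    have hdigit : ∀ i < j + 1, (if Heavy p k S i then 0 else slot p k S i) < sketchBase p k :=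
      fun i _ => by
        split_ifs
        exacts [hP.base_pos, slot_lt hP.prime.pos k S i]
    simpa only [hS, ite_mul, zero_mul] using sum_mul_pow_lt hdigit
  refine .put ?_ ⟨?_, ?_, ?_, ?_, ?_⟩
  · simpa [hM.hZ, hrest.slot_eq] using hP.lt_of_le_pow hS_lt.le (by omega)
  · simpa [squeeze_succ_of_neg hlight] using hsep.heavyH_eq
  · simpa [squeeze_succ_of_neg hlight] using hsep.heavyS_eq
  · simp [hM.hZ, hrest.slot_eq, hS]
  · simpa [hcount] using hsep.pn_eq
  · simpa [hcount] using hsep.pz_eq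

theorem nextCmd_spec (hP : Params n k p B) (hM : Ready n k p M) (hrest : Unread n k p H S j M)
    (hj : j < k) (hH : H < 2 ^ B) (hS : S < 2 ^ B) :
    WP B nextCmd (Unread n k p H S (j + 1)) M := by
  have hqz : M cell_qz * sketchBase p k = sketchBase p k ^ (j + 1) := by
    rw [hrest.qz_eq, pow_succ]
  have hrestS : M cell_restS / sketchBase p k = S / sketchBase p k ^ (j + 1) := by
    rw [hrest.restS_eq, Nat.div_div_eq_div_mul, pow_succ]
  have hrestH : M cell_restH / n = H / n ^ (j + 1) := by
    rw [hrest.restH_eq, Nat.div_div_eq_div_mul, pow_succ]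
  refine .put_seq ?_ <| .put_seq ?_ <| .put ?_ ⟨?_, ?_, ?_⟩
  · simpa [hM.hZ, hqz] using hP.lt_of_le_pow le_rfl (by omega)
  · simpa [hM.hZ, hrestS] using (Nat.div_le_self _ _).trans_lt hS
  · simpa [hM.hn, hrestH] using (Nat.div_le_self _ _).trans_lt hH
  · simp [hM.hZ, hqz]
  · simp [hM.hZ, hrestS]
  · simp [hM.hn, hrestH]

theorem Separated.frame (h : Separated n k p H S j M) {L : List ℕ} {M' : ℕ →₀ ℕ}
    (hf : ∀ a ∉ L, M' a = M a)
    (hL : ∀ a ∈ [cell_heavyH, cell_heavyS, cell_lightS, cell_pn, cell_pz], a ∉ L := by decide) :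
    Separated n k p H S j M' where
  heavyH_eq := (hf _ (hL _ (by decide))).trans h.heavyH_eq
  heavyS_eq := (hf _ (hL _ (by decide))).trans h.heavyS_eq
  lightS_eq := (hf _ (hL _ (by decide))).trans h.lightS_eq
  pn_eq := (hf _ (hL _ (by decide))).trans h.pn_eq
  pz_eq := (hf _ (hL _ (by decide))).trans h.pz_eq

theorem Unread.frame (h : Unread n k p H S j M) {L : List ℕ} {M' : ℕ →₀ ℕ}
    (hf : ∀ a ∉ L, M' a = M a) (hL : ∀ a ∈ [cell_qz, cell_restS, cell_restH], a ∉ L := by decide) :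
    Unread n k p H S j M' where
  qz_eq := (hf _ (hL _ (by decide))).trans h.qz_eq
  restS_eq := (hf _ (hL _ (by decide))).trans h.restS_eq
  restH_eq := (hf _ (hL _ (by decide))).trans h.restH_eq

open StreamRAM.Expr in
theorem separateCmd_spec (hP : Params n k p B) (hM : Ready n k p M) (hH : M cell_H < 2 ^ B)
    (hS : M cell_S < 2 ^ B) :
    WP B separateCmd (Separated n k p (M cell_H) (M cell_S) k) M := by
  refine .put_seq hP.zero_lt <| .put_seq hP.zero_lt <| .put_seq hP.zero_lt <|
    .put_seq hP.one_lt <| .put_seq hP.one_lt <| .put_seq hP.one_lt <|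
    .put_seq (by simpa) <| .put_seq (by simpa) <| .forLoop (m := k)
      (I := fun j M' => Separated n k p (M cell_H) (M cell_S) j M' ∧
        Unread n k p (M cell_H) (M cell_S) j M')
      (by decide) (by decide) (by simp [hM.hk]) (hP.lt_of_le_p hP.k_lt_p.le)
      ⟨by constructor <;> simp [squeeze], by constructor <;> simp⟩ ?_ fun _ _ h => h.1
  rintro j hj M' hf - ⟨hsep, hrest⟩
  have hM' : Ready n k p M' :=
    hM.update.update.update.update.update.update.update.update.frame hf
  have hheavy : (op .lt (reg cell_k) (reg cell_restS % reg cell_Z % reg cell_Q)).val M' ≠ 0 ↔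
      Heavy p k (M cell_S) j := by simp [hM'.hk, hM'.hZ, hM'.hQ, hrest.slot_eq, Heavy]
  refine .seq <| (WP.ite (fun h => heavyCmd_spec hP hM' hsep hrest hj (hheavy.1 h))
    fun h => lightCmd_spec hP hM' hsep hrest hj fun hc => hheavy.2 hc h).imp
    fun M₁ hf₁ hsep₁ => (nextCmd_spec hP (hM'.frame hf₁) (hrest.frame hf₁) hj hH hS).imp
      fun M₂ hf₂ hrest₂ => ⟨(hsep₁.frame hf₂).frame (update_frame M₂ cell_j (j + 1)),
        hrest₂.frame (update_frame M₂ cell_j (j + 1))⟩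

end Separate

/-! ### Processing an update -/

open StreamRAM.Expr in
/-- Search for the list of the light edges. -/
def decodeCmd : Cmd :=
  cell_G ::= reg cell_H ;; search cell_Y (lit 1 - op .eq (reg cell_acc) (reg cell_lightS)) loadCmd

open StreamRAM.Expr in
/-- Search for an extension of the list of the heavy vertices that covers the edges in `Y`. -/
def coverCmd : Cmd :=
  search cell_X (lit 1 - op .lt (reg cell_acc) (reg cell_Zk))
    (cell_G ::= reg cell_heavyH + reg cell_X * reg cell_pn ;; loadCmd)

open StreamRAM.Expr in
/-- Replace the vertices without a heavy star, so that the new edge is covered, too. -/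
def rebuildCmd : Cmd :=
  separateCmd ;; decodeCmd ;;
  cell_Y ::= reg cell_Y * reg cell_N + reg cell_edge ;;
  coverCmd ;;
  cell_S ::= reg cell_heavyS + reg cell_acc ;;
  cell_H ::= reg cell_G

open StreamRAM.Expr in
/-- The code of the edge with ends `u` and `v`. -/
def edgeExpr : Expr :=
  op .lt (reg cell_u) (reg cell_v) * (reg cell_u * reg cell_n + reg cell_v) +
    op .lt (reg cell_v) (reg cell_u) * (reg cell_v * reg cell_n + reg cell_u)

open StreamRAM.Expr in
/-- Handle the update of the edge in `cell_edge`, given its load in `cell_acc`. -/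
def storeCmd : Cmd :=
  .ite (op .lt (reg cell_acc) (reg cell_Zk))
    (.ite (reg cell_ins)
      (cell_S ::= reg cell_S + reg cell_acc)
      (cell_S ::= reg cell_S - reg cell_acc))
    rebuildCmd

open StreamRAM.Expr in
/-- Handle an update of the stream. -/
def updateCmd : Cmd :=
  cell_edge ::= edgeExpr ;; cell_Y ::= reg cell_edge ;; cell_G ::= reg cell_H ;;
  loadCmd ;; storeCmd

section EdgesOf

variable {n Y e : ℕ}

theorem edgesOf_single (he : 0 < e) (hen : e < n * n) : edgesOf n e = {e} := by
  rw [edgesOf, Nat.digits_of_lt _ _ he.ne' hen]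
  rfl

theorem edgesOf_mul_add (hn : 2 ≤ n) (he : 0 < e) (hen : e < n * n) :
    edgesOf n (Y * (n * n) + e) = e ::ₘ edgesOf n Y := by
  rw [edgesOf_of_ne_zero hn (by omega), mul_comm, Nat.mul_add_mod, Nat.mod_eq_of_lt hen,
    Nat.mul_add_div (by positivity), Nat.div_eq_of_lt hen, add_zero]

theorem lt_of_mem_edgesOf (hn : 2 ≤ n) (he : e ∈ edgesOf n Y) : e < n * n :=
  Nat.digits_lt_base (by nlinarith) (Multiset.mem_coe.1 he)

theorem exists_edgesOf_eq (hn : 2 ≤ n) (E : Finset ℕ) (hE : ∀ e ∈ E, 0 < e ∧ e < n * n) :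
    ∃ Y < (n * n) ^ #E, edgesOf n Y = E.val := by
  have hbase : 1 < n * n := by nlinarith
  refine ⟨Nat.ofDigits (n * n) E.toList, ?_, ?_⟩
  · rw [← E.length_toList]
    exact Nat.ofDigits_lt_base_pow_length hbase fun e he => (hE e (mem_toList.1 he)).2
  · rw [edgesOf, Nat.digits_ofDigits _ hbase _ fun e he => (hE e (mem_toList.1 he)).2]
    · exact Finset.coe_toList E
    · exact fun h => (hE _ (mem_toList.1 (List.getLast_mem h))).1.ne'

end EdgesOf

/-- `Transition n k e E b E'`: an update of the edge with code `e`, an insertion if `b = 1` and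
a deletion if `b = 0`, turns the set `E` of edges into `E'`. -/
inductive Transition (n k e : ℕ) (E : Finset ℕ) : ℕ → Finset ℕ → Prop
  | insert {T : Finset ℕ} : e ∉ E → IsSmallCover n k T (insert e E) →
      Transition n k e E 1 (insert e E)
  | erase : e ∈ E → Transition n k e E 0 (E.erase e)

section Specs

variable {n k p B : ℕ} {M : ℕ →₀ ℕ} {E : Finset ℕ} {H S : ℕ}

theorem Params.card_le (hP : Params n k p B) (hE : IsCodes n E) : #E + 1 ≤ p := by
  linarith [hE.card_le, hP.le_p]

theorem Represents.lt_two_pow (h : Represents n k p E H S) (hP : Params n k p B)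
    (hE : #E ≤ p) : S < 2 ^ B :=
  hP.lt_of_le_pow (h.eq_loadSum.trans_le
    (loadSum_lt_of_forall_firstHit_lt hP.prime.pos hE h.firstHit_lt).le) (Nat.le_add_right k 3)

theorem Represents.exists_edgesOf_eq_lightEdges (h : Represents n k p E H S) (hP : Params n k p B)
    (hE : IsCodes n E) :
    ∃ Y < (n * n) ^ (k * k), edgesOf n Y = (lightEdges n k p E H S).val := by
  obtain ⟨Y, hY, hYE⟩ := exists_edgesOf_eq hP.two_le (lightEdges n k p E H S) fun e he =>
    have heE := filter_subset _ _ he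
    ⟨hE.pos heE, (hE e heE).1⟩
  refine ⟨Y, hY.trans_le (Nat.pow_le_pow_right (by nlinarith [hP.two_le]) ?_), hYE⟩
  exact h.card_lightEdges_le hP.one_lt_p (Nat.le_of_succ_le (hP.card_le hE))

theorem Represents.edgesOf_eq_lightEdges (h : Represents n k p E H S) (hP : Params n k p B)
    (hE : IsCodes n E) {Y : ℕ} (hY : Y < (n * n) ^ (k * k))
    (heq : loadSum n k p H (edgesOf n Y) = lightSlots k p S) :
    edgesOf n Y = (lightEdges n k p E H S).val := by
  have hp : n * n < p := by linarith [hP.le_p]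
  exact h.eq_lightEdges hP.prime hP.k_lt_p (Nat.le_of_succ_le (hP.card_le hE))
    (fun e he => (hE e he).1.trans hp) (fun e he => (lt_of_mem_edgesOf hP.two_le he).trans hp)
    ((card_edgesOf_le hP.two_le hY).trans (Nat.le_of_succ_le hP.sq_lt_p.le)) heq

theorem decodeCmd_spec (hP : Params n k p B) (hM : Ready n k p M) (hE : IsCodes n E)
    (hrep : Represents n k p E (M cell_H) S) (hH : M cell_H < 2 ^ B)
    (hS : M cell_lightS = lightSlots k p S) :
    WP B decodeCmd (fun M' => M' cell_Y < (n * n) ^ (k * k) ∧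
      edgesOf n (M' cell_Y) = (lightEdges n k p E (M cell_H) S).val) M := by
  obtain ⟨Y, hY, hYE⟩ := hrep.exists_edgesOf_eq_lightEdges hP hE
  have hle : (n * n) ^ (k * k) ≤ (n * n) ^ (k * k + 1) :=
    Nat.pow_le_pow_right (by nlinarith [hP.two_le]) (Nat.le_succ _)
  refine .put_seq (by simpa) <| .search (N := Y) (R := fun _ _ => True)
    (good := fun Y => loadSum n k p (M cell_H) (edgesOf n Y) = M cell_lightS) (by decide)
    (by rw [hYE, hS, hrep.lightSlots_eq hP.prime.pos (Nat.le_of_succ_le (hP.card_le hE))])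
    (hP.lt_of_le_list (hY.le.trans hle)) ?_ ?_
  · rintro j hj M' hf rfl
    have hG : M' cell_G = M cell_H := by simp [hf cell_G (by decide)]
    have hlightS : M' cell_lightS = M cell_lightS := by simp [hf cell_lightS (by decide)]
    refine (loadCmd_spec hP (hM.update.frame hf) (hG ▸ hH) (by omega)).imp
      fun M'' hf'' hacc => ⟨?_, trivial⟩
    rw [Expr.val_one_sub_eq_eq_zero, ← hG, ← hacc, ← hlightS, ← hf'' cell_lightS (by decide)]
    rfl
  · rintro j hj hgood M' - rfl -
    exact ⟨by omega, hrep.edgesOf_eq_lightEdges hP hE (by omega) (hgood.trans hS)⟩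

theorem coverCmd_spec (hP : Params n k p B) (hM : Ready n k p M)
    (hY : M cell_Y < (n * n) ^ (k * k + 1)) (hH : M cell_heavyH < n ^ k) (hpn : M cell_pn ≤ n ^ k)
    {X : ℕ} (hX : X < n ^ k)
    (hlt : loadSum n k p (M cell_heavyH + X * M cell_pn) (edgesOf n (M cell_Y)) <
      sketchBase p k ^ k) :
    WP B coverCmd (fun M' => ∃ X', M' cell_G = M cell_heavyH + X' * M cell_pn ∧
      M' cell_G < 2 ^ B ∧
      M' cell_acc = loadSum n k p (M' cell_G) (edgesOf n (M cell_Y)) ∧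
      M' cell_acc < sketchBase p k ^ k) M := by
  have hGB {j : ℕ} (hj : j ≤ X) : M cell_heavyH + j * M cell_pn < 2 ^ B := by
    refine hP.lt_of_le_pow_of_le hP.sq_le_base (j := k) ?_ (Nat.le_add_right k 3)
    rw [mul_pow]
    nlinarith [Nat.mul_le_mul (hj.trans_lt hX) hpn]
  refine .search (N := X)
    (good := fun j => loadSum n k p (M cell_heavyH + j * M cell_pn) (edgesOf n (M cell_Y)) <
      sketchBase p k ^ k)
    (R := fun j M' => M' cell_G = M cell_heavyH + j * M cell_pn ∧
      M' cell_acc = loadSum n k p (M' cell_G) (edgesOf n (M cell_Y)))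
    (by decide) hlt
    (hP.lt_of_le_pow_of_le hP.n_le_base hX.le (Nat.le_add_right k 3)) ?_ ?_
  · rintro j hj M' hf rfl
    have hM' : Ready n k p M' := hM.frame hf
    have hheavyH : M' cell_heavyH = M cell_heavyH := hf _ (by decide)
    have hpn : M' cell_pn = M cell_pn := hf _ (by decide)
    have hYM : M' cell_Y = M cell_Y := hf _ (by decide)
    refine .put_seq (by simpa [hheavyH, hpn] using hGB hj) <|
      (loadCmd_spec hP hM'.update (by simpa [hheavyH, hpn] using hGB hj) (by simpa [hYM])).imp
        fun M'' hf'' hacc => ?_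
    have hG : M'' cell_G = M cell_heavyH + M' cell_X * M cell_pn := by
      rw [hf'' _ (by decide)]
      simp [hheavyH, hpn]
    have hacc' : M'' cell_acc = loadSum n k p (M'' cell_G) (edgesOf n (M cell_Y)) := by
      rw [hacc, hG]
      simp [hheavyH, hpn, hYM]
    refine ⟨?_, hG, hacc'⟩
    rw [Expr.val_one_sub_lt_eq_zero, ← hG, ← hacc', ← (hM'.update.frame hf'').hZk]
    rfl
  · rintro j hj hgood M' - rfl ⟨hG, hacc⟩
    exact ⟨_, hG, hG ▸ hGB hj, hacc, by rwa [hacc, hG]⟩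

theorem coverCmd_represents (hP : Params n k p B) (hM : Ready n k p M) (hE : IsCodes n E)
    (hrep : Represents n k p E H S) {e : ℕ} {T : Finset ℕ} (he : e ∉ E)
    (hT : IsSmallCover n k T (insert e E)) (hY : M cell_Y < (n * n) ^ (k * k + 1))
    (hedges : edgesOf n (M cell_Y) = e ::ₘ (lightEdges n k p E H S).val)
    (hheavyH : M cell_heavyH = heavyVertices n k p H S)
    (hpn : M cell_pn = n ^ heavyCount k p S) :
    WP B coverCmd (fun M' => M' cell_G < 2 ^ B ∧
      Represents n k p (insert e E) (M' cell_G) (heavySlots k p S + M' cell_acc)) M := by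
  have hn : 0 < n := by linarith [hP.two_le]
  have hcard : #E ≤ p := Nat.le_of_succ_le (hP.card_le hE)
  have hpow : n ^ heavyCount k p S ≤ n ^ k := Nat.pow_le_pow_right hn (heavyCount_le k p S)
  obtain ⟨X, hX, hlt⟩ := hrep.exists_rebuilt hn hP.one_lt_p (Nat.lt_of_succ_lt hP.sq_lt_p) hcard
    (fun a ha => hE a ha) hT
  refine (coverCmd_spec hP hM hY (hheavyH ▸ (heavyVertices_lt hn k p H S).trans_le hpow)
    (hpn ▸ hpow) hX (by rwa [hheavyH, hpn, hedges])).imp ?_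
  rintro M' - ⟨X', hG, hGB, hacc, hacc_lt⟩
  rw [hheavyH, hpn] at hG
  rw [hacc, hG, hedges] at hacc_lt
  refine ⟨hGB, ?_⟩
  rw [hacc, hG, hedges]
  exact hrep.of_rebuilt hn hP.one_lt_p hcard he hacc_lt

theorem rebuildCmd_spec (hP : Params n k p B) (hM : Ready n k p M) (hE : IsCodes n E)
    (hrep : Represents n k p E (M cell_H) (M cell_S)) (hH : M cell_H < 2 ^ B)
    {T : Finset ℕ} (hE' : IsCodes n (insert (M cell_edge) E)) (hedge : M cell_edge ∉ E)
    (hT : IsSmallCover n k T (insert (M cell_edge) E)) :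
    WP B rebuildCmd (fun M' => Ready n k p M' ∧
      Represents n k p (insert (M cell_edge) E) (M' cell_H) (M' cell_S)) M := by
  have hS : M cell_S < 2 ^ B := hrep.lt_two_pow hP (Nat.le_of_succ_le (hP.card_le hE))
  refine .seq <| (separateCmd_spec hP hM hH hS).imp fun M₁ hf₁ hsep => .seq ?_
  have hM₁ : Ready n k p M₁ := hM.frame hf₁
  have hH₁ : M₁ cell_H = M cell_H := hf₁ _ (by decide)
  refine (decodeCmd_spec hP hM₁ hE (by rwa [hH₁]) (by rwa [hH₁]) hsep.lightS_eq).imp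
    fun M₂ hf₂ hdecode => ?_
  obtain ⟨hY, hedges⟩ := hH₁ ▸ hdecode
  have hM₂ : Ready n k p M₂ := hM₁.frame hf₂
  have hsep₂ : Separated n k p (M cell_H) (M cell_S) k M₂ := hsep.frame hf₂
  have hedge₂ : M₂ cell_edge = M cell_edge := (hf₂ _ (by decide)).trans (hf₁ _ (by decide))
  have hedge_mem := mem_insert_self (M cell_edge) E
  have hedge_lt := (hE' _ hedge_mem).1
  have hY' : M₂ cell_Y * (n * n) + M cell_edge < (n * n) ^ (k * k + 1) := by
    rw [pow_succ]
    nlinarith [hY, hedge_lt]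
  refine .put_seq (by simpa [hM₂.hN, hedge₂] using hP.lt_of_le_list hY'.le) <| .seq <|
    (coverCmd_represents (e := M cell_edge) hP hM₂.update hE hrep hedge hT
      (by simpa [hM₂.hN, hedge₂])
      (by simp [hM₂.hN, hedge₂, edgesOf_mul_add hP.two_le (hE'.pos hedge_mem) hedge_lt, hedges])
      (by simpa [heavyVertices] using hsep₂.heavyH_eq)
      (by simpa [heavyCount] using hsep₂.pn_eq)).imp
    fun M₃ hf₃ ⟨hG, hrep'⟩ => ?_
  have hheavyS : M₃ cell_heavyS = heavySlots k p (M cell_S) := by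
    rw [hf₃ _ (by decide)]
    simpa [heavySlots] using hsep₂.heavyS_eq
  rw [← hheavyS] at hrep'
  refine .put_seq (hrep'.lt_two_pow hP ((card_insert_le _ _).trans (hP.card_le hE))) <|
    .put (by simpa) ⟨(hM₂.update.frame hf₃).update.update, by simpa using hrep'⟩

theorem edgeExpr_val (hM : Ready n k p M) (huv : M cell_u ≠ M cell_v) :
    edgeExpr.val M = edgeCode n (M cell_u) (M cell_v) := by
  rcases huv.lt_or_gt with h | h <;> simp [edgeExpr, edgeCode, hM.hn, h, h.not_gt, h.le]

theorem loadSum_singleton (n k p H e : ℕ) : loadSum n k p H {e} = load n k p H e := by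
  simp [loadSum]

theorem firstHit_lt_iff_load_lt (hp : 1 < p) {e : ℕ} :
    firstHit n e k H < k ↔ load n k p H e < sketchBase p k ^ k := by
  rw [← loadSum_singleton]
  refine ⟨fun h => ?_, fun h => firstHit_lt_of_loadSum_lt hp h (Multiset.mem_singleton_self e)⟩
  exact loadSum_lt_of_forall_firstHit_lt (by omega) (by simpa using hp.le) (by simpa)

theorem storeCmd_spec (hP : Params n k p B) (hM : Ready n k p M) (hE : IsCodes n E)
    {E' : Finset ℕ} (hE' : IsCodes n E') (hrep : Represents n k p E (M cell_H) (M cell_S))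
    (hH : M cell_H < 2 ^ B) (hacc : M cell_acc = load n k p (M cell_H) (M cell_edge))
    (htrans : Transition n k (M cell_edge) E (M cell_ins) E') :
    WP B storeCmd
      (fun M' => Ready n k p M' ∧ Represents n k p E' (M' cell_H) (M' cell_S)) M := by
  have hhit : M cell_acc < M cell_Zk ↔ firstHit n (M cell_edge) k (M cell_H) < k := by
    rw [hacc, hM.hZk, firstHit_lt_iff_load_lt hP.one_lt_p]
  generalize hb : M cell_ins = b at htrans
  refine .ite (fun hlt => ?_) (fun hge => ?_)
  · have hlt' := hhit.1 ((Expr.val_lt_ne_zero ..).1 hlt)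
    cases htrans with
    | insert hedge =>
      have hrep' := hrep.insert hedge hlt'
      rw [← hacc] at hrep'
      refine .ite (fun _ => ?_) (fun h => absurd (hb.symm.trans h) one_ne_zero)
      exact .put (hrep'.lt_two_pow hP ((card_insert_le _ _).trans (hP.card_le hE)))
        ⟨hM.update, by simpa using hrep'⟩
    | erase hedge =>
      have hrep' := hrep.erase hedge
      rw [← hacc] at hrep'
      refine .ite (fun h => absurd hb h) (fun _ => ?_)
      exact .put (hrep'.lt_two_pow hP (card_erase_le.trans (Nat.le_of_succ_le (hP.card_le hE))))
        ⟨hM.update, by simpa using hrep'⟩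
  · have hge' := mt hhit.2 ((Expr.val_lt_eq_zero ..).1 hge).not_gt
    cases htrans with
    | insert hedge hT => exact rebuildCmd_spec hP hM hE hrep hH hE' hedge hT
    | erase hedge => exact absurd (hrep.firstHit_lt _ hedge) hge'

theorem updateCmd_spec (hP : Params n k p B) (hM : Ready n k p M) (hE : IsCodes n E)
    {E' : Finset ℕ} (hE' : IsCodes n E') (hrep : Represents n k p E (M cell_H) (M cell_S))
    (hH : M cell_H < 2 ^ B) (huv : M cell_u ≠ M cell_v)
    (htrans : Transition n k (edgeCode n (M cell_u) (M cell_v)) E (M cell_ins) E') :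
    WP B updateCmd
      (fun M' => Ready n k p M' ∧ Represents n k p E' (M' cell_H) (M' cell_S)) M := by
  set e := edgeCode n (M cell_u) (M cell_v)
  obtain ⟨hpos, hlt⟩ : 0 < e ∧ e < n * n := by
    generalize M cell_ins = b at htrans
    cases htrans with
    | insert => exact ⟨hE'.pos (mem_insert_self e E), (hE' e (mem_insert_self e E)).1⟩
    | erase hedge => exact ⟨hE.pos hedge, (hE e hedge).1⟩
  have hval : edgeExpr.val M = e := edgeExpr_val hM huv
  have hle : n * n ≤ (n * n) ^ (k * k + 1) := Nat.le_self_pow (Nat.succ_ne_zero _) _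
  have heB : e < 2 ^ B := hP.lt_of_le_list (hlt.le.trans hle)
  refine .put_seq (by rwa [hval]) <| .put_seq (by simpa [hval]) <| .put_seq (by simpa) <|
    .seq <| (loadCmd_spec hP hM.update.update.update (by simpa)
      (by simpa [hval] using hlt.trans_le hle)).imp fun M' hf hacc => ?_
  have hM' : Ready n k p M' := hM.update.update.update.frame hf
  have hH' : M' cell_H = M cell_H := by simp [hf cell_H (by decide)]
  have hS' : M' cell_S = M cell_S := by simp [hf cell_S (by decide)]
  have hedge' : M' cell_edge = e := by simp [hf cell_edge (by decide), hval]
  have hins' : M' cell_ins = M cell_ins := by simp [hf cell_ins (by decide)]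
  refine storeCmd_spec hP hM' hE hE' (by rwa [hH', hS']) (by rwa [hH']) ?_ (by rwa [hedge', hins'])
  rw [hacc, hedge', hH', ← loadSum_singleton, ← edgesOf_single hpos hlt]
  simp [hval]

end Specs

/-! ### Initialization and extraction -/

open StreamRAM.Expr in
/-- Search for the least prime from `N + 2` on, by computing least divisors. -/
def primeCmd : Cmd :=
  search cell_X (lit 1 - op .eq (reg cell_r + lit 2) (reg cell_p))
    (cell_p ::= reg cell_N + reg cell_X + lit 2 ;;
      search cell_r (reg cell_p % (reg cell_r + lit 2)) .skip)

open StreamRAM.Expr in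
/-- Store in the cell `a` the power of the cell `b` with the exponent in the cell `l`. -/
def powCmd (a b l : ℕ) : Cmd := a ::= lit 1 ;; forLoop cell_i l (a ::= reg a * reg b)

open StreamRAM.Expr in
/-- Compute the bases of the sketches, from `k` and `p`. -/
def basesCmd : Cmd :=
  cell_Q ::= reg cell_p * reg cell_p ;;
  cell_R ::= reg cell_k + reg cell_k + lit 1 ;;
  powCmd cell_Z cell_Q cell_R ;; powCmd cell_Zk cell_Z cell_k

open StreamRAM.Expr in
/-- Replace `k` by `min k n`, and compute the other parameters. -/
def initCmd : Cmd :=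
  cell_k ::= reg cell_k - (reg cell_k - reg cell_n) ;;
  cell_N ::= reg cell_n * reg cell_n ;;
  primeCmd ;; basesCmd

open StreamRAM.Expr in
/-- Print the last digit of `H` in base `n`, and remove it from `H`. -/
def printCmd : Cmd :=
  .emit (reg cell_H % reg cell_n) ;;
  cell_H ::= reg cell_H / reg cell_n ;;
  cell_i ::= reg cell_i + lit 1

/-- Print the digits of `H`, which destroys `H`. -/
def printLoop : Cmd := .loop (.op .lt (.reg cell_i) (.reg cell_k)) printCmd

/-- Print the list of vertices. -/
def extractCmd : Cmd := cell_i ::= .lit 0 ;; printLoop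

section Specs

variable {B : ℕ} {M : ℕ →₀ ℕ}

theorem sketchBase_mono {p q : ℕ} (h : p ≤ q) (k : ℕ) : sketchBase p k ≤ sketchBase q k :=
  Nat.pow_le_pow_left (Nat.mul_le_mul h h) _

theorem search_minFac_spec (hp : 2 ≤ M cell_p) (hB : M cell_p < 2 ^ B) :
    WP B (search cell_r (.reg cell_p % (.reg cell_r + .lit 2)) .skip)
      (fun M' => M' cell_r + 2 = (M cell_p).minFac) M := by
  have hle : (M cell_p).minFac ≤ M cell_p := Nat.minFac_le (by omega)
  have htwo : 2 ≤ (M cell_p).minFac := (Nat.minFac_prime (by omega)).two_le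
  refine .search (N := (M cell_p).minFac - 2) (good := fun j => j + 2 ∣ M cell_p)
    (R := fun _ _ => True) (by decide) ?_ (by omega) ?_ ?_
  · rw [Nat.sub_add_cancel htwo]
    exact Nat.minFac_dvd _
  · rintro j - M' hf rfl
    exact .skip ⟨by simp [hf cell_p (by decide), Nat.dvd_iff_mod_eq_zero], trivial⟩
  · rintro j hj hdvd M' - rfl -
    exact le_antisymm (by omega) (Nat.minFac_le_of_dvd (by omega) hdvd)

theorem primeCmd_spec {q : ℕ} (hq : q.Prime) (hNq : M cell_N + 2 ≤ q) (hB : q < 2 ^ B) :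
    WP B primeCmd
      (fun M' => (M' cell_p).Prime ∧ M cell_N + 2 ≤ M' cell_p ∧ M' cell_p ≤ q) M := by
  refine .search (N := q - (M cell_N + 2)) (good := fun j => (M cell_N + j + 2).Prime)
    (R := fun j M' => M' cell_p = M cell_N + j + 2) (by decide) ?_ (by omega) ?_ ?_
  · rwa [show M cell_N + (q - (M cell_N + 2)) + 2 = q by omega]
  · rintro j hj M' hf rfl
    have hN : M' cell_N = M cell_N := hf _ (by decide)
    refine .put_seq (by simp only [Expr.val_add, Expr.val_reg, Expr.val_lit]; omega) <|
      (search_minFac_spec (by simp) (by simp; omega)).imp fun M'' hf'' hr => ?_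
    have hp : M'' cell_p = M cell_N + M' cell_X + 2 := by simp [hf'' cell_p (by decide), hN]
    refine ⟨?_, hp⟩
    rw [Expr.val_one_sub_eq_eq_zero, Nat.prime_def_minFac, ← hp]
    simp [hr, hp, hN]
  · rintro j hj hprime M' - rfl hp
    exact ⟨hp ▸ hprime, by omega, by omega⟩

theorem powCmd_spec {a b l : ℕ} (ha : a ≠ cell_i) (hb : b ≠ cell_i) (hl : l ≠ cell_i) (hab : a ≠ b)
    (hal : a ≠ l) (hpos : 0 < M b) (hB : M b ^ M l < 2 ^ B) (hlB : M l < 2 ^ B) :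
    WP B (powCmd a b l) (fun M' => M' a = M b ^ M l) M := by
  have hone : 1 < 2 ^ B := (Nat.one_le_pow _ _ hpos).trans_lt hB
  refine .put_seq hone <| .forLoop (m := M l) (I := fun j M' => M' a = M b ^ j)
    (by simp [Cmd.targets, put, hl, hal.symm]) (by simp [Cmd.targets, put, ha.symm])
    (by simp [hal.symm]) hlB (by simp [ha]) ?_ fun M' _ h => h
  rintro j hj M' hf - hpow
  have hb' : M' b = M b := by simp [hf b (by simp [Cmd.targets, put, hb, hab.symm]), hab.symm]
  have hpow' : M' a * M' b = M b ^ (j + 1) := by rw [hpow, hb', pow_succ]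
  refine .put ?_ (by simp [ha, hpow'])
  simpa [hpow'] using (Nat.pow_le_pow_right hpos hj).trans_lt hB

theorem basesCmd_spec {n k p : ℕ} (hn : M cell_n = n) (hk : M cell_k = k) (hN : M cell_N = n * n)
    (hp : M cell_p = p) (hkp : 2 * k + 1 ≤ p) (hB : sketchBase p k ^ (k + 3) < 2 ^ B) :
    WP B basesCmd (Ready n k p) M := by
  suffices hbases : WP B basesCmd (fun M' => M' cell_Q = p * p ∧ M' cell_Z = sketchBase p k ∧
      M' cell_Zk = sketchBase p k ^ k) M from hbases.imp fun M' hf ⟨hQ, hZ, hZk⟩ =>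
    ⟨(hf _ (by decide)).trans hn, (hf _ (by decide)).trans hk, (hf _ (by decide)).trans hN,
      (hf _ (by decide)).trans hp, hQ, hZ, hZk⟩
  have hpos : 0 < p := by omega
  have lt_pow {x j : ℕ} (hx : x ≤ sketchBase p k ^ j) (hj : j ≤ k + 3) : x < 2 ^ B :=
    lt_of_le_sketchBase_pow hpos hB hx hj
  have lt_base {x : ℕ} (hx : x ≤ sketchBase p k) : x < 2 ^ B :=
    lt_pow (j := 1) (by rwa [pow_one]) (by omega)
  have hQB : p * p < 2 ^ B := lt_base (Nat.le_self_pow (Nat.succ_ne_zero _) _)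
  have hRB : 2 * k + 1 < 2 ^ B := lt_base (hkp.trans (le_sketchBase p k))
  refine .put_seq (by simpa [hp]) <| .put_seq (by simp [hk]; omega) ?_
  set M₁ := (M.update cell_Q _).update cell_R _ with hM₁
  have hQ₁ : M₁ cell_Q = p * p := by simp [hM₁, hp]
  have hR₁ : M₁ cell_R = 2 * k + 1 := by simp [hM₁, hk, two_mul]
  have hZB : M₁ cell_Q ^ M₁ cell_R < 2 ^ B := by rw [hQ₁, hR₁]; exact lt_base le_rfl
  refine .seq <| (powCmd_spec (by decide) (by decide) (by decide) (by decide) (by decide)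
    (by rw [hQ₁]; positivity) hZB (by rwa [hR₁])).imp fun M₂ hf₂ hZ => ?_
  rw [hQ₁, hR₁] at hZ
  have hk₂ : M₂ cell_k = k := by simp [hf₂ cell_k (by decide), hM₁, hk]
  refine (powCmd_spec (by decide) (by decide) (by decide) (by decide) (by decide)
    (hZ ▸ sketchBase_pos hpos k) (by rw [hZ, hk₂]; exact lt_pow le_rfl (by omega))
    (by omega)).imp fun M₃ hf₃ hZk => ?_
  refine ⟨?_, ?_, ?_⟩
  · rw [hf₃ _ (by decide), hf₂ _ (by decide), hQ₁]
  · rw [hf₃ _ (by decide), hZ, sketchBase]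
  · rw [hZk, hZ, hk₂, sketchBase]

theorem initCmd_spec {n k₀ : ℕ} (hn : 1 ≤ n) (hn₀ : M cell_n = n) (hk₀ : M cell_k = k₀)
    (hB : sketchBase (2 * (n * n + 1)) (min k₀ n) ^ (min k₀ n + 3) < 2 ^ B) :
    WP B initCmd (fun M' => ∃ p, Ready n (min k₀ n) p M' ∧ p.Prime ∧ n * n + 2 ≤ p ∧
      sketchBase p (min k₀ n) ^ (min k₀ n + 3) < 2 ^ B) M := by
  obtain ⟨q, hq, hNq, hq_le⟩ := Nat.exists_prime_lt_and_le_two_mul (n * n + 1) (by omega)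
  generalize hk : min k₀ n = k at hB ⊢
  have hkn : k ≤ n := hk ▸ min_le_right _ _
  have hk₀k : k₀ - (k₀ - n) = k := by rw [tsub_tsub_eq_min, hk]
  have hB_of_le {p : ℕ} (hp : p ≤ q) : sketchBase p k ^ (k + 3) < 2 ^ B :=
    (Nat.pow_le_pow_left (sketchBase_mono (hp.trans hq_le) k) _).trans_lt hB
  have hqB : q < 2 ^ B := lt_of_le_sketchBase_pow (j := 1) hq.pos (hB_of_le le_rfl)
    (by rw [pow_one]; exact le_sketchBase q k) (Nat.le_add_left 1 (k + 2))
  refine .put_seq (by simp [hn₀, hk₀, hk₀k]; nlinarith) <| .put_seq (by simp [hn₀]; omega) <|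
    .seq <| (primeCmd_spec hq (by simpa [hn₀]) hqB).imp fun M₁ hf₁ ⟨hp, hNp, hpq⟩ => ?_
  have hn₁ : M₁ cell_n = n := by simp [hf₁ cell_n (by decide), hn₀]
  have hk₁ : M₁ cell_k = k := by simp [hf₁ cell_k (by decide), hn₀, hk₀, hk₀k]
  have hN₁ : M₁ cell_N = n * n := by simp [hf₁ cell_N (by decide), hn₀]
  have hp_le : n * n + 2 ≤ M₁ cell_p := by simpa [hn₀] using hNp
  exact (basesCmd_spec hn₁ hk₁ hN₁ rfl (by nlinarith) (hB_of_le hpq)).imp fun M₂ _ hM₂ =>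
    ⟨_, hM₂, hp, hp_le, hB_of_le hpq⟩

theorem ev_printCmd (hi : M cell_i + 1 < 2 ^ B) (hH : M cell_H < 2 ^ B) :
    ∃ M', Ev B printCmd M M' [M cell_H % M cell_n] 3 ∧ M' cell_n = M cell_n ∧
      M' cell_k = M cell_k ∧ M' cell_H = M cell_H / M cell_n ∧ M' cell_i = M cell_i + 1 :=
  ⟨_, .seq (.emit _ _) (.seq (.assign _ ((Nat.div_le_self _ _).trans_lt hH))
    (.assign _ (by simpa))), by simp, by simp, by simp, by simp⟩

theorem ev_printLoop {l : ℕ} (hl : M cell_k = M cell_i + l) (hk : M cell_k < 2 ^ B)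
    (hH : M cell_H < 2 ^ B) :
    ∃ M', Ev B printLoop M M' ((List.range l).map (digit (M cell_n) (M cell_H))) (4 * l + 1) := by
  induction l generalizing M with
  | zero => exact ⟨M, .loop_false ((Expr.val_lt_eq_zero M _ _).2 (by simp [hl]))⟩
  | succ l ih =>
    obtain ⟨M₁, hbody, hn₁, hk₁, hH₁, hi₁⟩ := ev_printCmd (B := B) (M := M) (by omega) hH
    obtain ⟨M', hloop⟩ := ih (M := M₁) (by omega) (by omega)
      (hH₁ ▸ (Nat.div_le_self _ _).trans_lt hH)
    have hout : (List.range (l + 1)).map (digit (M cell_n) (M cell_H)) =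
        [M cell_H % M cell_n] ++ (List.range l).map (digit (M₁ cell_n) (M₁ cell_H)) := by
      rw [hn₁, hH₁, List.range_succ_eq_map, List.map_cons, List.map_map, digit_zero_right,
        List.singleton_append, funext (digit_div_self _ _)]
      rfl
    rw [hout, show 4 * (l + 1) + 1 = 1 + 3 + (4 * l + 1) by ring]
    exact ⟨M', .loop_true ((Expr.val_lt_ne_zero M _ _).2 (by simp; omega)) hbody hloop⟩

theorem ev_extractCmd (hk : M cell_k < 2 ^ B) (hH : M cell_H < 2 ^ B) :
    ∃ M', Ev B extractCmd M M' ((List.range (M cell_k)).map (digit (M cell_n) (M cell_H)))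
      (4 * M cell_k + 2) := by
  have hstart : Ev B (cell_i ::= .lit 0) M (M.update cell_i 0) [] 1 :=
    .assign _ (Nat.zero_lt_of_lt hk)
  obtain ⟨M', hloop⟩ := ev_printLoop (B := B) (M := M.update cell_i 0) (l := M cell_k)
    (by simp) (by simpa) (by simpa)
  rw [show 4 * M cell_k + 2 = 1 + (4 * M cell_k + 1) by ring]
  exact ⟨M', by simpa [extractCmd] using hstart.seq hloop⟩

end Specs

/-! ### The codes of the edges of a graph -/

open Classical in
/-- The codes of the edges of a graph. -/
noncomputable def codes {n : ℕ} (G : SimpleGraph (Fin n)) : Finset ℕ :=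
  ({x | G.Adj x.1 x.2} : Finset (Fin n × Fin n)).image fun x => edgeCode n x.1 x.2

section Codes

variable {n k : ℕ} {G : SimpleGraph (Fin n)} {u v : Fin n}

theorem mem_codes {e : ℕ} : e ∈ codes G ↔ ∃ u v : Fin n, G.Adj u v ∧ edgeCode n u v = e := by
  simp [codes]

theorem edgeCode_eq_iff {a b : Fin n} :
    edgeCode n u v = edgeCode n a b ↔ (u = a ∧ v = b) ∨ (u = b ∧ v = a) := by
  constructor
  · intro h
    have hmin : min (u : ℕ) v = min (a : ℕ) b := by
      rw [← edgeCode_div u.2 v.2, h, edgeCode_div a.2 b.2]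
    have hmax : max (u : ℕ) v = max (a : ℕ) b := by
      rw [← edgeCode_mod u.2 v.2, h, edgeCode_mod a.2 b.2]
    simp only [Fin.ext_iff]
    omega
  · rintro (⟨rfl, rfl⟩ | ⟨rfl, rfl⟩)
    exacts [rfl, edgeCode_comm ..]

theorem edgeCode_mem_codes : edgeCode n u v ∈ codes G ↔ G.Adj u v := by
  refine mem_codes.trans ⟨?_, fun h => ⟨u, v, h, rfl⟩⟩
  rintro ⟨a, b, hab, h⟩
  rcases edgeCode_eq_iff.1 h with ⟨rfl, rfl⟩ | ⟨rfl, rfl⟩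
  exacts [hab, hab.symm]

theorem isCodes_codes (G : SimpleGraph (Fin n)) : IsCodes n (codes G) := by
  intro e he
  obtain ⟨u, v, huv, rfl⟩ := mem_codes.1 he
  rw [edgeCode_div u.2 v.2, edgeCode_mod u.2 v.2, min_lt_max]
  exact ⟨edgeCode_lt u.2 v.2, fun h => huv.ne (Fin.ext h)⟩

theorem codes_bot : codes (⊥ : SimpleGraph (Fin n)) = ∅ := by simp [codes]

theorem codes_sup_edge (G : SimpleGraph (Fin n)) (huv : u ≠ v) :
    codes (G ⊔ SimpleGraph.edge u v) = insert (edgeCode n u v) (codes G) := by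
  ext e
  simp only [mem_insert, mem_codes, SimpleGraph.sup_adj, SimpleGraph.edge_adj]
  constructor
  · rintro ⟨a, b, hab | ⟨hab, -⟩, rfl⟩
    exacts [.inr ⟨a, b, hab, rfl⟩, .inl (edgeCode_eq_iff.2 hab)]
  · rintro (rfl | ⟨a, b, hab, rfl⟩)
    exacts [⟨u, v, .inr ⟨.inl ⟨rfl, rfl⟩, huv⟩, rfl⟩, ⟨a, b, .inl hab, rfl⟩]

theorem codes_sdiff_edge (G : SimpleGraph (Fin n)) (u v : Fin n) :
    codes (G \ SimpleGraph.edge u v) = (codes G).erase (edgeCode n u v) := by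
  ext e
  simp only [mem_erase, mem_codes, SimpleGraph.sdiff_adj, SimpleGraph.edge_adj]
  constructor
  · rintro ⟨a, b, ⟨hab, hne⟩, rfl⟩
    exact ⟨fun h => hne ⟨edgeCode_eq_iff.1 h, hab.ne⟩, a, b, hab, rfl⟩
  · rintro ⟨hne, a, b, hab, rfl⟩
    exact ⟨a, b, ⟨hab, fun h => hne (edgeCode_eq_iff.2 h.1)⟩, rfl⟩

theorem exists_isSmallCover_codes {T : Finset (Fin n)} (hT : #T ≤ k) (hG : G.IsVertexCover T) :
    ∃ T', IsSmallCover n (min k n) T' (codes G) := by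
  refine ⟨T.map Fin.valEmbedding, ?_, fun t ht => ?_, fun e he => ?_⟩
  · rw [card_map]
    exact le_min hT (card_finset_fin_le T)
  · obtain ⟨a, -, rfl⟩ := mem_map.1 ht
    exact a.2
  · obtain ⟨u, v, huv, rfl⟩ := mem_codes.1 he
    have hmem {w : Fin n} (hw : w ∈ (T : Set (Fin n))) : (w : ℕ) ∈ T.map Fin.valEmbedding :=
      mem_map_of_mem Fin.valEmbedding hw
    rw [edgeCode_div u.2 v.2, edgeCode_mod u.2 v.2]
    rcases le_total (u : ℕ) v with h | h
    · rw [min_eq_left h, max_eq_right h]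
      exact (hG huv).imp hmem hmem
    · rw [min_eq_right h, max_eq_left h]
      exact (hG huv).symm.imp hmem hmem

theorem graphAfter_append_singleton (S : List (EdgeUpdate n)) (x : EdgeUpdate n) :
    graphAfter (S ++ [x]) = x.apply (graphAfter S) :=
  List.foldl_concat ..

theorem transition_of_stream {S S' : List (EdgeUpdate n)} {x : EdgeUpdate n}
    (hS : IsDynamicStream (S ++ x :: S')) (hk : VertexCoverPromise k (S ++ x :: S')) :
    Transition n (min k n) (edgeCode n x.u x.v) (codes (graphAfter S)) (if x.ins then 1 else 0)
      (codes (graphAfter (S ++ [x]))) := by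
  have hins : x.ins = true ↔ ¬ (graphAfter S).Adj x.u x.v := by
    simpa using hS S.length (by simp)
  obtain ⟨T, hT, hcover⟩ := hk (S.length + 1) (by simp)
  have htake : (S ++ x :: S').take (S.length + 1) = S ++ [x] := by simp [List.take_append]
  rw [htake] at hcover
  obtain ⟨T', hT'⟩ := exists_isSmallCover_codes hT hcover
  rw [graphAfter_append_singleton, EdgeUpdate.apply] at hT' ⊢
  rw [← edgeCode_mem_codes] at hins
  split_ifs at hT' ⊢ with hx
  · rw [codes_sup_edge _ x.ne] at hT' ⊢
    exact .insert (hins.1 hx) hT'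
  · rw [codes_sdiff_edge]
    exact .erase (not_not.1 (mt hins.2 hx))

theorem isSolution_of_represents {p H s : ℕ} (hn : 1 ≤ n)
    (h : Represents n (min k n) p (codes G) H s) :
    IsSolution k G ((List.range (min k n)).map (digit n H)) := by
  refine ⟨by simp, fun a ha => ?_, fun u v huv => ?_⟩
  · obtain ⟨i, -, rfl⟩ := List.mem_map.1 ha
    exact digit_lt hn H i
  · have hlt := h.firstHit_lt _ (edgeCode_mem_codes.2 huv)
    have hmem : digit n H (firstHit n (edgeCode n u v) (min k n) H) ∈
        (List.range (min k n)).map (digit n H) :=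
      List.mem_map_of_mem (List.mem_range.2 hlt)
    have hhit := hit_firstHit hlt
    rw [Hit, edgeCode_div u.2 v.2, edgeCode_mod u.2 v.2] at hhit
    obtain h | h : digit n H (firstHit n (edgeCode n u v) (min k n) H) = u ∨
      digit n H (firstHit n (edgeCode n u v) (min k n) H) = v := by omega
    exacts [.inl (by rwa [h] at hmem), .inr (by rwa [h] at hmem)]

end Codes

/-! ### Runs of the algorithm -/

/-- The streaming algorithm of the theorem. It does not flip any coins. -/
def coverAlgorithm : StreamAlgorithm := ⟨initCmd, updateCmd, extractCmd⟩

/-- A bound for the weights of the three programs of the algorithm. -/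
def algorithmWeight : ℕ := max initCmd.weight (max updateCmd.weight extractCmd.weight)

/-- In the state `s` between two updates, the memory represents the graph `G`. -/
structure Maintains {n : ℕ} (k p B : ℕ) (G : SimpleGraph (Fin n)) (s : State) : Prop where
  ready : Ready n k p s.mem
  represents : Represents n k p (codes G) (s.mem cell_H) (s.mem cell_S)
  bounded : Bounded 37 B s.mem
  out_eq : s.out = []
  peak_le : s.peak ≤ spaceBound 37 B algorithmWeight

theorem WP.exists_exec {B r w : ℕ} {p : Cmd} {Q : (ℕ →₀ ℕ) → Prop} {s : State}
    (h : WP B p Q s.mem) (ω : ℕ → Bool) (hr : ∀ a ∈ p.targets, a < r) (hw : p.weight ≤ w)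
    (hs : Bounded r B s.mem) :
    ∃ m t, Exec ω p s t ∧ Q t.mem ∧ Advance r B w s [] m t := by
  obtain ⟨M', m, hev, hQ⟩ := h
  obtain ⟨t, hexec, rfl, hadv⟩ := hev.exists_exec ω hr hw hs rfl
  exact ⟨m, t, hexec, hQ, hadv⟩

set_option maxRecDepth 4000 in
theorem lt_of_mem_targets_updateCmd : ∀ a ∈ updateCmd.targets, a < 37 := by
  decide

theorem Advance.feed {r B w n : ℕ} {s : State} {x : EdgeUpdate n} (h : Bounded r B s.mem)
    (hr : 6 ≤ r) (hn : n ≤ 2 ^ B) (hB : 1 < 2 ^ B) : Advance r B w s [] 0 (s.feed x) := by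
  have hins : Advance r B w s [] 0 (s.write 3 (if x.ins then 1 else 0)) :=
    .write h (by omega) (by split_ifs <;> omega)
  have hu := Advance.write (w := w) hins.bounded (a := 4) (by omega) (x.u.2.trans_le hn)
  exact (hins.trans hu).trans (.write hu.bounded (a := 5) (by omega) (x.v.2.trans_le hn))

theorem Maintains.update {n k p B : ℕ} (hP : Params n k p B) {G G' : SimpleGraph (Fin n)}
    {s : State} (hs : Maintains k p B G s) (ω : ℕ → Bool) {x : EdgeUpdate n}
    (htrans : Transition n k (edgeCode n x.u x.v) (codes G) (if x.ins then 1 else 0) (codes G')) :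
    ∃ t, Exec ω updateCmd (s.feed x) t ∧ Maintains k p B G' t := by
  have hfeed : Advance 37 B algorithmWeight s [] 0 (s.feed x) :=
    .feed hs.bounded (by decide) (hP.lt_of_le_base hP.n_le_base).le hP.one_lt
  have hmem : (s.feed x).mem = ((s.mem.update cell_ins (if x.ins then 1 else 0)).update
      cell_u x.u).update cell_v x.v := rfl
  have huv : (x.u : ℕ) ≠ x.v := fun h => x.ne (Fin.ext h)
  have hspec := updateCmd_spec hP (M := (s.feed x).mem) (hs.ready.update.update.update)
    (isCodes_codes G) (isCodes_codes G') (by simpa [hmem] using hs.represents)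
    (hfeed.bounded.1 _) (by simpa [hmem]) (by simpa [hmem] using htrans)
  obtain ⟨m, t, hexec, ⟨hready, hrep⟩, hadv⟩ := hspec.exists_exec (w := algorithmWeight) ω
    lt_of_mem_targets_updateCmd (le_max_of_le_right (le_max_left _ _)) hfeed.bounded
  have h := hfeed.trans hadv
  exact ⟨t, hexec, hready, hrep, h.bounded, by simpa [hs.out_eq] using h.out_eq,
    h.peak_le.trans (max_le hs.peak_le le_rfl)⟩

theorem Maintains.pass {n k p B : ℕ} (hP : 2 ≤ n → Params n (min k n) p B) (ω : ℕ → Bool)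
    {S S' : List (EdgeUpdate n)} (hS : IsDynamicStream (S ++ S'))
    (hk : VertexCoverPromise k (S ++ S')) {s : State}
    (hs : Maintains (min k n) p B (graphAfter S) s) :
    ∃ t, Pass ω updateCmd S' s t ∧ Maintains (min k n) p B (graphAfter (S ++ S')) t := by
  induction S' generalizing S s with
  | nil => exact ⟨s, .nil s, by rwa [List.append_nil]⟩
  | cons x S' ih =>
    have hn : 2 ≤ n := by
      have huv : (x.u : ℕ) ≠ x.v := fun h => x.ne (Fin.ext h)
      omega
    obtain ⟨t, hexec, ht⟩ := hs.update (hP hn) ω (transition_of_stream hS hk)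
    rw [List.append_cons] at hS hk ⊢
    obtain ⟨t', hpass, ht'⟩ := ih hS hk ht
    exact ⟨t', .cons hexec hpass, ht'⟩

theorem exists_init {n k D B : ℕ} (hn : 1 ≤ n)
    (hB : sketchBase (2 * (n * n + 1)) (min k n) ^ (min k n + 3) < 2 ^ B)
    (hstart : Bounded 37 B (startState n k D).mem) (ω : ℕ → Bool) :
    ∃ p r, Exec ω initCmd (startState n k D) r ∧ (2 ≤ n → Params n (min k n) p B) ∧
      Maintains (min k n) p B (⊥ : SimpleGraph (Fin n)) r := by
  have hspec : WP B initCmd (fun M' => ∃ p, Ready n (min k n) p M' ∧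
      (2 ≤ n → Params n (min k n) p B) ∧ M' cell_S = 0) (startState n k D).mem :=
    (initCmd_spec hn (by simp [startState]) (by simp [startState]) hB).imp
      fun M' hf ⟨p, hready, hp, hnp, hpB⟩ => ⟨p, hready,
        fun hn₂ => ⟨hn₂, min_le_right k n, hp, hnp, hpB⟩,
        (hf cell_S (by decide)).trans (by simp [startState])⟩
  obtain ⟨m, r, hexec, ⟨p, hready, hP, hS⟩, hadv⟩ := hspec.exists_exec (w := algorithmWeight) ω
    (by decide) (le_max_left _ _) hstart
  exact ⟨p, r, hexec, hP, hready, by rw [codes_bot, hS]; exact .empty .., hadv.bounded,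
    hadv.out_eq, hadv.peak_le.trans (max_le (hstart.memBits_le_spaceBound _) le_rfl)⟩

theorem Maintains.exists_extract {n k p B : ℕ} (hn : 1 ≤ n) {G : SimpleGraph (Fin n)} {s : State}
    (hs : Maintains (min k n) p B G s) (ω : ℕ → Bool) :
    ∃ t, Exec ω extractCmd s t ∧ IsSolution k G t.out ∧
      t.peak ≤ spaceBound 37 B algorithmWeight ∧
      t.time ≤ s.time + (4 * k + 2) * (algorithmWeight * (B + 1)) := by
  obtain ⟨M', hev⟩ := ev_extractCmd (hs.bounded.1 cell_k) (hs.bounded.1 cell_H)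
  obtain ⟨t, hexec, -, hadv⟩ := hev.exists_exec ω (w := algorithmWeight) (by decide)
    (le_max_of_le_right (le_max_right _ _)) hs.bounded rfl
  rw [hs.ready.hn, hs.ready.hk] at hadv
  refine ⟨t, hexec, ?_, hadv.peak_le.trans (max_le hs.peak_le le_rfl), hadv.time_le.trans ?_⟩
  · rw [hadv.out_eq, hs.out_eq, List.nil_append]
    exact isSolution_of_represents hn hs.represents
  · gcongr
    exact min_le_left k n

theorem exists_run_coverAlgorithm {n k D B : ℕ} (hn : 1 ≤ n)
    (hB : sketchBase (2 * (n * n + 1)) (min k n) ^ (min k n + 3) < 2 ^ B)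
    (hstart : Bounded 37 B (startState n k D).mem) {S : List (EdgeUpdate n)}
    (hS : IsDynamicStream S) (hk : VertexCoverPromise k S) (ω : ℕ → Bool) :
    ∃ s t, coverAlgorithm.Run ω k D S s t ∧ IsSolution k (graphAfter S) t.out ∧
      t.peak ≤ spaceBound 37 B algorithmWeight ∧
      t.time ≤ s.time + (4 * k + 2) * (algorithmWeight * (B + 1)) := by
  obtain ⟨p, r, hinit, hP, hr⟩ := exists_init hn hB hstart ω
  obtain ⟨s, hpass, hs⟩ := hr.pass (S := []) hP ω hS hk
  obtain ⟨t, hextract, ht⟩ := hs.exists_extract hn ω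
  exact ⟨s, t, ⟨r, hinit, hpass, hextract⟩, ht⟩

/-! ### Asymptotics -/

/-- A number of bits that suffices for the cells of the algorithm with the parameters `n`, `k` and
`D`. -/
def cellBits (n k D : ℕ) : ℕ :=
  (2 * n.size + 1) * (2 * ((2 * min k n + 1) * (min k n + 3))) + D.size + k.size + 1

theorem two_mul_sq_add_one_le (n : ℕ) : 2 * (n * n + 1) ≤ 2 ^ (2 * n.size + 1) := by
  have hsq : (n + 1) * (n + 1) ≤ 2 ^ n.size * 2 ^ n.size :=
    Nat.mul_le_mul n.lt_size_self n.lt_size_self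
  rw [pow_succ, two_mul n.size, pow_add]
  nlinarith

theorem sketchBase_pow_lt_two_pow_cellBits (n k D : ℕ) :
    sketchBase (2 * (n * n + 1)) (min k n) ^ (min k n + 3) < 2 ^ cellBits n k D := by
  rw [sketchBase, ← pow_two, ← pow_mul, ← pow_mul]
  calc _ ≤ (2 ^ (2 * n.size + 1)) ^ (2 * ((2 * min k n + 1) * (min k n + 3))) :=
        Nat.pow_le_pow_left (two_mul_sq_add_one_le n) _
    _ = 2 ^ ((2 * n.size + 1) * (2 * ((2 * min k n + 1) * (min k n + 3)))) := (pow_mul ..).symm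
    _ < 2 ^ cellBits n k D := Nat.pow_lt_pow_right one_lt_two (by unfold cellBits; omega)

theorem bounded_startState {r B n k D : ℕ} (hr : 3 ≤ r) (hn : n < 2 ^ B) (hk : k < 2 ^ B)
    (hD : D < 2 ^ B) : Bounded r B (startState n k D).mem := by
  have hzero : Bounded r B 0 := ⟨fun _ => Nat.zero_lt_of_lt hn, fun _ _ => rfl⟩
  rw [startState, ← Finsupp.zero_update]
  exact ((hzero.update (by omega) hn).update (by omega) hk).update (by omega) hD

theorem bounded_startState_cellBits (n k D : ℕ) :
    Bounded 37 (cellBits n k D) (startState n k D).mem := by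
  have hpos : 0 < 2 * ((2 * min k n + 1) * (min k n + 3)) := by positivity
  have hn := Nat.le_mul_of_pos_right (2 * n.size + 1) hpos
  refine bounded_startState (by decide) ?_ ?_ ?_ <;> rw [← Nat.size_le, cellBits] <;> omega

theorem size_le_one_add_two_mul_log {x : ℕ} (hx : 1 ≤ x) :
    (x.size : ℝ) ≤ 1 + 2 * Real.log x := by
  have hpow : 2 ^ (x.size - 1) ≤ x := Nat.lt_size.1 (Nat.sub_one_lt (Nat.size_pos.2 hx).ne')
  have hlog : Real.log (2 ^ (x.size - 1)) ≤ Real.log x :=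
    Real.log_le_log (by positivity) (by exact_mod_cast hpow)
  have hsize : (1 : ℝ) ≤ x.size := by exact_mod_cast Nat.size_pos.2 hx
  rw [Real.log_pow, Nat.cast_sub (Nat.size_pos.2 hx), Nat.cast_one] at hlog
  nlinarith [Real.log_two_gt_d9]

theorem size_ceil_le_three_add_two_mul_log {y : ℝ} (hy : 1 ≤ y) :
    (⌈y⌉₊.size : ℝ) ≤ 3 + 2 * Real.log y := by
  have hceil : (⌈y⌉₊ : ℝ) ≤ 2 * y := by linarith [Nat.ceil_lt_add_one (zero_le_one.trans hy)]
  have hpos : 1 ≤ ⌈y⌉₊ := Nat.one_le_ceil_iff.2 (by linarith)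
  have hlog : Real.log ⌈y⌉₊ ≤ Real.log 2 + Real.log y := by
    rw [← Real.log_mul two_ne_zero (by positivity)]
    exact Real.log_le_log (by exact_mod_cast hpos) hceil
  linarith [size_le_one_add_two_mul_log hpos, Real.log_two_lt_d9]

theorem cellBits_add_one_le_of_size_le {n k D : ℕ} {L : ℝ} (hL : 0 ≤ L)
    (hn : (n.size : ℝ) ≤ 1 + 2 * L) (hD : (D.size : ℝ) ≤ 3 + 2 * L) :
    (cellBits n k D : ℝ) + 1 ≤ 100 * (max k 1 : ℝ) ^ 2 * (1 + L) := by
  set K : ℝ := max k 1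
  set m : ℝ := ((min k n : ℕ) : ℝ) with hm
  have hK : 1 ≤ K := le_max_right _ _
  have hkK : (k : ℝ) ≤ K := le_max_left _ _
  have hsize : (k.size : ℝ) ≤ K :=
    le_trans (by exact_mod_cast Nat.size_le.2 Nat.lt_two_pow_self) hkK
  have hmK : m ≤ K := le_trans (Nat.cast_le.2 (min_le_left k n)) hkK
  have : 0 ≤ m := Nat.cast_nonneg _
  have hKK : K ≤ K ^ 2 := by nlinarith
  have hLK : L ≤ K ^ 2 * L := le_mul_of_one_le_left hL (hK.trans hKK)
  have hprod : (2 * m + 1) * (m + 3) ≤ 12 * K ^ 2 := by nlinarith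
  calc (cellBits n k D : ℝ) + 1
      = (2 * n.size + 1) * (2 * ((2 * m + 1) * (m + 3))) + D.size + k.size + 2 := by
        rw [cellBits, hm]; push_cast; ring
    _ ≤ (2 * (1 + 2 * L) + 1) * (2 * (12 * K ^ 2)) + (3 + 2 * L) + K + 2 := by gcongr
    _ ≤ 100 * K ^ 2 * (1 + L) := by nlinarith

theorem log_div_nonneg {n : ℕ} {δ : ℝ} (hn : 1 ≤ n) (hδ₀ : 0 < δ) (hδ₁ : δ < 1) :
    0 ≤ Real.log (n / δ) :=
  Real.log_nonneg ((one_le_div₀ hδ₀).2 (hδ₁.le.trans (by exact_mod_cast hn)))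

theorem cellBits_add_one_le {n k : ℕ} {δ : ℝ} (hn : 1 ≤ n) (hδ₀ : 0 < δ) (hδ₁ : δ < 1) :
    (cellBits n k ⌈1 / δ⌉₊ : ℝ) + 1 ≤ 100 * (max k 1 : ℝ) ^ 2 * (1 + Real.log (n / δ)) := by
  have hn' : (1 : ℝ) ≤ n := by exact_mod_cast hn
  have hδ : 1 ≤ 1 / δ := (one_le_div₀ hδ₀).2 hδ₁.le
  have hle_n : (n : ℝ) ≤ n / δ := le_div_self (by positivity) hδ₀ hδ₁.le
  have hle_δ : 1 / δ ≤ n / δ := by gcongr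
  refine cellBits_add_one_le_of_size_le (log_div_nonneg hn hδ₀ hδ₁) ?_ ?_
  · linarith [size_le_one_add_two_mul_log hn, Real.log_le_log (by positivity) hle_n]
  · linarith [size_ceil_le_three_add_two_mul_log hδ, Real.log_le_log (by positivity) hle_δ]

theorem spaceBound_le {r : ℕ} (hr : 1 ≤ r) (B w : ℕ) :
    spaceBound r B w ≤ (r * r + w) * (B + 1) := by
  unfold spaceBound
  nlinarith [Nat.mul_le_mul hr (Nat.zero_le (r * B)), Nat.mul_le_mul_right (r * B) hr]

theorem max_one_pow_three_le_two_pow (k : ℕ) : (max k 1 : ℝ) ^ 3 ≤ 2 ^ (2 * k ^ 2) := by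
  rcases k.eq_zero_or_pos with rfl | hk
  · simp
  · have hk' : (1 : ℝ) ≤ k := by exact_mod_cast hk
    have hsq : (k : ℝ) ^ 2 ≤ (2 : ℝ) ^ k ^ 2 := by
      exact_mod_cast (Nat.lt_two_pow_self (n := k ^ 2)).le
    rw [max_eq_left hk']
    calc (k : ℝ) ^ (3 : ℕ) ≤ (k : ℝ) ^ (2 + 2) := pow_le_pow_right₀ hk' (by decide)
      _ = (k : ℝ) ^ 2 * (k : ℝ) ^ 2 := pow_add ..
      _ ≤ (2 : ℝ) ^ k ^ 2 * (2 : ℝ) ^ k ^ 2 := by gcongr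
      _ = 2 ^ (2 * k ^ 2) := by rw [two_mul, pow_add]

theorem ofReal_le_coinMeasure {P : (ℕ → Bool) → Prop} (hP : ∀ ω, P ω) {x : ℝ} (hx : x ≤ 1) :
    ENNReal.ofReal x ≤ coinMeasure {ω | P ω} := by
  rw [show {ω | P ω} = Set.univ from Set.eq_univ_of_forall hP, coinMeasure,
    MeasureTheory.measure_univ]
  exact ENNReal.ofReal_le_one.2 hx

end StreamRAM

open StreamRAM in
theorem mainTheorem3_general :
    ∃ (A : StreamAlgorithm) (C : ℕ), ∀ (n k : ℕ) (δ : ℝ), 1 ≤ n → 0 < δ → δ < 1 →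
      ∀ S : List (EdgeUpdate n), IsDynamicStream S → VertexCoverPromise k S →
        ∀ ω : ℕ → Bool, ∃ s t : State,
          A.Run ω k ⌈1 / δ⌉₊ S s t ∧ IsSolution k (graphAfter S) t.out ∧
          (t.peak : ℝ) ≤ C * (max k 1 : ℝ) ^ 2 * (1 + Real.log (n / δ)) ∧
          (t.time : ℝ) - s.time ≤ C * (max k 1 : ℝ) ^ 3 * (1 + Real.log (n / δ)) := by
  refine ⟨coverAlgorithm, 100 * (1369 + 6 * algorithmWeight), ?_⟩
  intro n k δ hn hδ₀ hδ₁ S hS hk ω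
  obtain ⟨s, t, hrun, hsol, hpeak, htime⟩ := exists_run_coverAlgorithm hn
    (sketchBase_pow_lt_two_pow_cellBits n k _) (bounded_startState_cellBits n k ⌈1 / δ⌉₊) hS hk ω
  have hbits := cellBits_add_one_le (k := k) hn hδ₀ hδ₁
  have hlog := log_div_nonneg hn hδ₀ hδ₁
  generalize cellBits n k ⌈1 / δ⌉₊ = B, algorithmWeight = w at *
  set K : ℝ := max k 1
  have hrounds : (4 * k + 2 : ℝ) ≤ 6 * K := by
    linarith [le_max_left (k : ℝ) 1, le_max_right (k : ℝ) 1]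
  have hpeak' : (t.peak : ℝ) ≤ (1369 + w) * (B + 1) := by
    exact_mod_cast hpeak.trans (spaceBound_le (by decide) B w)
  have htime' : (t.time : ℝ) - s.time ≤ (4 * k + 2) * (w * (B + 1)) := by
    rw [sub_le_iff_le_add']
    exact_mod_cast htime
  refine ⟨s, t, hrun, hsol, ?_, ?_⟩ <;> push_cast
  · calc (t.peak : ℝ) ≤ (1369 + 6 * w) * (100 * K ^ 2 * (1 + Real.log (n / δ))) := by
          refine hpeak'.trans ?_
          gcongr
          linarith [(Nat.cast_nonneg w : (0 : ℝ) ≤ w)]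
      _ = 100 * (1369 + 6 * w) * K ^ 2 * (1 + Real.log (n / δ)) := by ring
  · calc (t.time : ℝ) - s.time ≤ 6 * K * (w * (100 * K ^ 2 * (1 + Real.log (n / δ)))) :=
          htime'.trans (by gcongr)
      _ = 100 * (6 * w) * K ^ 3 * (1 + Real.log (n / δ)) := by ring
      _ ≤ 100 * (1369 + 6 * w) * K ^ 3 * (1 + Real.log (n / δ)) := by gcongr; linarith

theorem mainTheorem3 (c : ℕ) :
    ∃ (A : StreamRAM.StreamAlgorithm) (C d : ℕ),
      ∀ (n k : ℕ) (δ : ℝ), 1 ≤ n → 0 < δ → δ < 1 →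
      ∀ S : List (StreamRAM.EdgeUpdate n),
        StreamRAM.IsDynamicStream S → S.length ≤ n ^ c → StreamRAM.VertexCoverPromise k S →
        (∀ ω : ℕ → Bool, ∃ s t : StreamRAM.State,
          A.Run ω k ⌈1 / δ⌉₊ S s t ∧
          (t.peak : ℝ) ≤ C * (max k 1 : ℝ) ^ 2 * (1 + Real.log (n / δ)) ^ d ∧
          (t.time : ℝ) - s.time ≤ C * 2 ^ (2 * k ^ 2) * (1 + Real.log (n / δ)) ^ d) ∧
        ENNReal.ofReal (1 - δ / (n : ℝ) ^ c) ≤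
          StreamRAM.coinMeasure {ω | ∃ s t : StreamRAM.State,
            A.Run ω k ⌈1 / δ⌉₊ S s t ∧
            StreamRAM.IsSolution k (StreamRAM.graphAfter S) t.out} := by
  obtain ⟨A, C, h⟩ := mainTheorem3_general
  refine ⟨A, C, 1, fun n k δ hn hδ₀ hδ₁ S hS _ hk => ⟨fun ω => ?_,
    StreamRAM.ofReal_le_coinMeasure (fun ω => ?_) (sub_le_self _ (by positivity))⟩⟩
  all_goals obtain ⟨s, t, hrun, hsol, hpeak, htime⟩ := h n k δ hn hδ₀ hδ₁ S hS hk ω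
  · have hlog := StreamRAM.log_div_nonneg hn hδ₀ hδ₁
    refine ⟨s, t, hrun, by rwa [pow_one], htime.trans ?_⟩
    rw [pow_one]
    gcongr
    exact StreamRAM.max_one_pow_three_le_two_pow k
  · exact ⟨s, t, hrun, hsol⟩
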